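/- Let $m,l\ge 1$ be integers and $\alpha\ge 0$ real, and put $w(x)=x^{\alpha}\mathrm e^{-x}$ and $(k+\alpha)!=\Gamma(k+\alpha+1)$. Let $L_k^{(\alpha)}$ be the generalized Laguerre polynomials, and set \[ K(x,y)=\sqrt{w(x)w(y)}\sum_{k=0}^{m-1}\frac{k!}{(k+\alpha)!}L_k^{(\alpha)}(x)L_k^{(\alpha)}(y), \] \[ L_H(x,y)=\frac{m!}{(m+\alpha)!}\sqrt{w(x)w(y)}\,L_m^{(\alpha)}(x)L_m^{(\alpha)}(y),\qquad L_h(x,y)=\frac{(m-1)!}{(m-1+\alpha)!}\sqrt{w(x)w(y)}\,L_{m-1}^{(\alpha)}(x)L_{m-1}^{(\alpha)}(y). \] Let $f_1,\dots,f_l$ be real functions on $[0,\infty)$ such that $\int_0^\infty \prod_{r\in s}|f_r(x)|\,x^{k}w(x)\,\mathrm dx<\infty$ (integrability) for all $s\subseteq L=\{1,\dots,l\}$ and all integers $0\le k\le 2m$. For $n\ge 0$ consider the Wishart--Laguerre ensemble of $n$ eigenvalues, i.e. the probability measure on $[0,\infty)^n$ with density proportional to $\prod_{i<j}(x_i-x_j)^2\prod_{i}w(x_i)$,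 and the linear statistics $X_r=\sum_{i=1}^{n}f_r(x_i)$. For nonempty $p\subseteq L$ let $\kappa_{|p|}(\mathbf X_p)$, $\kappa^{+}_{|p|}(\mathbf X_p)$, $\kappa^{-}_{|p|}(\mathbf X_p)$ be the joint cumulants of $\mathbf X_p=\{X_r:r\in p\}$, \[ \sum_{\{P_1,\dots,P_s\}\in\mathcal P_p}(-1)^{s-1}(s-1)!\prod_{q=1}^{s}\mathbb E\Big[\prod_{r\in P_q}X_r\Big], \] in the ensembles with $n=m$, $n=m+1$ and $n=m-1$ eigenvalues respectively (with the same $\alpha$), where $\mathcal P_p$ is the set of set partitions of $p$. For a kernel $\Lambda(x,y)$ consider \[ \sum_{\{p_1,\dots,p_i\}\in\mathcal P_L}(-1)^{i-1}\sum_{\sigma\in C_i}\sum_{v=1}^{i}\int_{[0,\infty)^i}\Lambda(x_v,x_{\sigma(v)})\prod_{j=1}^{i}\prod_{r\in p_j}f_r(x_j)\prod_{\substack{1\le j\le i\\ j\ne v}}K(x_j,x_{\sigma(j)})\prod_{j=1}^{i}\mathrm dx_j , \] where $C_i$ is the set of cyclic permutations (single cycles of length $i$) of $\{1,\dots,i\}$,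 and denote it by $H_l(\mathbf X)$ when $\Lambda=L_H$ and by $h_l(\mathbf X)$ when $\Lambda=L_h$. Then \[ H_l(\mathbf X)=\sum_{\{p_1,\dots,p_i\}\in\mathcal P_L}\prod_{j=1}^{i}\left(\kappa^{+}_{|p_j|}(\mathbf X_{p_j})-\kappa_{|p_j|}(\mathbf X_{p_j})\right), \] \[ h_l(\mathbf X)=-\sum_{\{p_1,\dots,p_i\}\in\mathcal P_L}\prod_{j=1}^{i}\left(\kappa^{-}_{|p_j|}(\mathbf X_{p_j})-\kappa_{|p_j|}(\mathbf X_{p_j})\right). \] -/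

import Mathlib

open MeasureTheory

namespace WishartLaguerre

noncomputable section

/-- The Laguerre weight `w(x) = x ^ α * e ^ (-x)`. -/
def weight (α x : ℝ) : ℝ := x ^ α * Real.exp (-x)

/-- The generalized Laguerre polynomial
`L_k^{(α)}(x) = ∑_{i ≤ k} (-1)^i * binom (k + α) (k - i) * x ^ i / i!`, where
`binom (k + α) (k - i) = Γ(k + α + 1) / ((k - i)! * Γ(α + i + 1))`. -/
def laguerre (α : ℝ) (k : ℕ) (x : ℝ) : ℝ :=
  ∑ i ∈ Finset.range (k + 1),
    (-1) ^ i * (Real.Gamma (k + α + 1) / ((k - i).factorial * Real.Gamma (α + i + 1))) *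
      (x ^ i / i.factorial)

/-- `k! / (k + α)! * √(w(x) w(y)) * L_k^{(α)}(x) * L_k^{(α)}(y)`, with `(k + α)! = Γ(k + α + 1)`. -/
def laguerreTerm (α : ℝ) (k : ℕ) (x y : ℝ) : ℝ :=
  k.factorial / Real.Gamma (k + α + 1) * Real.sqrt (weight α x * weight α y) *
    laguerre α k x * laguerre α k y

/-- The correlation kernel `K(x, y)` of the ensemble with `m` eigenvalues. -/
def corrKernel (α : ℝ) (m : ℕ) (x y : ℝ) : ℝ :=
  ∑ k ∈ Finset.range m, laguerreTerm α k x y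

/-- The kernel `L_H`, built with the `m`-th Laguerre polynomial. -/
def kernelH (α : ℝ) (m : ℕ) (x y : ℝ) : ℝ := laguerreTerm α m x y

/-- The kernel `L_h`, built with the `(m - 1)`-th Laguerre polynomial (used for `1 ≤ m`). -/
def kernelh (α : ℝ) (m : ℕ) (x y : ℝ) : ℝ := laguerreTerm α (m - 1) x y

/-- The measure on `[0, ∞)^n` with density `∏_{i < j} (x_i - x_j)^2 * ∏_i x_i ^ α * e ^ (-x_i)`. -/
def unnormalizedEnsemble (α : ℝ) (n : ℕ) : Measure (Fin n → ℝ) :=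
  (volume.restrict (Set.univ.pi fun _ => Set.Ici 0)).withDensity fun x =>
    ENNReal.ofReal ((∏ i, ∏ j ∈ Finset.Ioi i, (x i - x j) ^ 2) * ∏ i, weight α (x i))

/-- The Wishart-Laguerre ensemble of `n` eigenvalues: the normalized measure. -/
def ensemble (α : ℝ) (n : ℕ) : Measure (Fin n → ℝ) :=
  (unnormalizedEnsemble α n Set.univ)⁻¹ • unnormalizedEnsemble α n

/-- The linear statistic `X = ∑_i g(x_i)`. -/
def linearStatistic (g : ℝ → ℝ) (n : ℕ) (x : Fin n → ℝ) : ℝ := ∑ i, g (x i)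

/-- The joint cumulant of the random variables `X_r`, `r ∈ s` (for nonempty `s`), namely
`∑_P (-1)^(|P| - 1) * (|P| - 1)! * ∏_{B ∈ P} E[∏_{r ∈ B} X_r]` over the set partitions `P` of `s`. -/
def jointCumulant {Ω ι : Type*} [MeasurableSpace Ω] [DecidableEq ι] (μ : Measure Ω)
    (X : ι → Ω → ℝ) (s : Finset ι) : ℝ :=
  ∑ P : Finpartition s, (-1) ^ (P.parts.card - 1) * ((P.parts.card - 1).factorial : ℝ) *
    ∏ B ∈ P.parts, ∫ ω, ∏ r ∈ B, X r ω ∂μ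

/-- `κ_{|p|}(X_p)` in the ensemble of `n` eigenvalues, where `X_r = ∑_i f_r(x_i)`. -/
def cumulant (α : ℝ) (n : ℕ) {l : ℕ} (f : Fin l → ℝ → ℝ) (p : Finset (Fin l)) : ℝ :=
  jointCumulant (ensemble α n) (fun r => linearStatistic (f r) n) p

open Classical in
/-- The decoupled integral with kernels `K` and `L`: a sum over the set partitions `P` of
`{1, …, l}`, over the cyclic permutations `σ` of the blocks of `P` (a single cycle through all of
them) and over a distinguished block `v`. There is one integration variable for each block. -/
def decoupledIntegral (K L : ℝ → ℝ → ℝ) {l : ℕ} (f : Fin l → ℝ → ℝ) : ℝ :=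
  ∑ P : Finpartition (Finset.univ : Finset (Fin l)), (-1) ^ (P.parts.card - 1) *
    ∑ σ : Equiv.Perm P.parts with σ.IsCycleOn Set.univ, ∑ v : P.parts,
      ∫ x : P.parts → ℝ in Set.univ.pi fun _ => Set.Ici 0,
        L (x v) (x (σ v)) * (∏ b : P.parts, ∏ r ∈ b.1, f r (x b)) *
          ∏ b ∈ Finset.univ.erase v, K (x b) (x (σ b))

/-- The decoupled integral `H_l(X)`. -/
def integralH (α : ℝ) (m : ℕ) {l : ℕ} (f : Fin l → ℝ → ℝ) : ℝ :=
  decoupledIntegral (corrKernel α m) (kernelH α m) f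

/-- The decoupled integral `h_l(X)`. -/
def integralh (α : ℝ) (m : ℕ) {l : ℕ} (f : Fin l → ℝ → ℝ) : ℝ :=
  decoupledIntegral (corrKernel α m) (kernelh α m) f

end

end WishartLaguerre

/-! Let φ_k be the orthonormal functions √(k!/(k+α)!) √w L_k and let A be the matrix with entries
A_{jk} = ∫ φ_j φ_k (exp(∑ t_r f_r) - 1), where t_r² = 0. Write D_n for the n-th leading principal
minor of 1 + A. Both sides of each identity are the coefficient of ∏_{r ∈ L} t_r in a ratio of such
minors.

Cumulant side: the density is a constant times det(φ_j(x_i))², so Andréief's identity makes D_n the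
moment generating function of the n-eigenvalue ensemble (`integral_prod_linearStatistic`). Cumulants
are the coefficients of log D_n, and a sum over partitions of products over blocks is an
exponential. Hence the right-hand sums are coefficients of exp(log D_n - log D_m) = D_n / D_m with n
= m + 1 or n = m - 1 (`partitionExp_sub_mul`).

Integral side: expanding every K as ∑_{j<m} φ_j φ_j turns a cyclic integral over q + 1 blocks into a
sum over closed paths c → k_1 → … → k_q → c with k_i < m, where c = m for L_H and c = m - 1 for L_h.
With the signs, the decoupled integral is a coefficient of the Neumann series A_{cc} - ∑
A_{ck}A_{kc} + … (`decoupledIntegral_eq_signedPathSum`). It terminates, because A has no constant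
term and the t_r are nilpotent.

Linear algebra joins the two. For c = m the series is the Schur complement of the m × m block minus
1, that is D_{m+1}/D_m - 1 (`leadingMinor_succ_eq_mul`). For c = m - 1 it is 1 minus the last
diagonal entry of (1 + A)⁻¹, that is 1 - D_{m-1}/D_m (`leadingMinor_mul_one_sub`). The constant 1
has no coefficient at the nonempty set L. -/

/-- Set functions on the finite subsets of `ι`, regarded as the multilinear power series
`∑ S, a S * ∏ r ∈ S, t r` in variables with `t r ^ 2 = 0`. -/
@[ext] structure SubsetSeries (ι : Type*) where
  /-- The coefficient of the monomial `∏ r ∈ S, t r`. -/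
  coeff : Finset ι → ℝ

/-! ### The ring of multilinear power series and its Euler derivations. -/

namespace SubsetSeries

section Additive

variable {ι : Type*}

instance : CoeFun (SubsetSeries ι) fun _ => Finset ι → ℝ := ⟨coeff⟩

instance : Zero (SubsetSeries ι) := ⟨⟨fun _ => 0⟩⟩

instance : Add (SubsetSeries ι) := ⟨fun a b => ⟨fun S => a S + b S⟩⟩

instance : Neg (SubsetSeries ι) := ⟨fun a => ⟨fun S => -a S⟩⟩

@[simp] theorem zero_apply (S : Finset ι) : (0 : SubsetSeries ι) S = 0 := rfl

@[simp] theorem add_apply (a b : SubsetSeries ι) (S : Finset ι) : (a + b) S = a S + b S := rfl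

@[simp] theorem neg_apply (a : SubsetSeries ι) (S : Finset ι) : (-a) S = -a S := rfl

theorem ext_apply {a b : SubsetSeries ι} (h : ∀ S : Finset ι, a S = b S) : a = b :=
  SubsetSeries.ext (funext h)

theorem congr_apply {a b : SubsetSeries ι} (h : a = b) (S : Finset ι) : a S = b S := by rw [h]

instance : AddCommGroup (SubsetSeries ι) where
  add_assoc a b c := ext_apply fun S => add_assoc (a S) (b S) (c S)
  zero_add a := ext_apply fun S => zero_add (a S)
  add_zero a := ext_apply fun S => add_zero (a S)
  add_comm a b := ext_apply fun S => add_comm (a S) (b S)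
  neg_add_cancel a := ext_apply fun S => neg_add_cancel (a S)
  nsmul := nsmulRec
  zsmul := zsmulRec

@[simp] theorem sub_apply (a b : SubsetSeries ι) (S : Finset ι) : (a - b) S = a S - b S := by
  rw [sub_eq_add_neg, add_apply, neg_apply, sub_eq_add_neg]

end Additive

variable {ι : Type*} [DecidableEq ι]

/-- The product is the subset convolution. -/
instance : Mul (SubsetSeries ι) := ⟨fun a b => ⟨fun S => ∑ T ∈ S.powerset, a T * b (S \ T)⟩⟩

instance : One (SubsetSeries ι) := ⟨⟨fun S => if S = ∅ then 1 else 0⟩⟩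

theorem mul_apply (a b : SubsetSeries ι) (S : Finset ι) :
    (a * b) S = ∑ T ∈ S.powerset, a T * b (S \ T) := rfl

theorem one_apply (S : Finset ι) : (1 : SubsetSeries ι) S = if S = ∅ then 1 else 0 := rfl

theorem mul_comm' (a b : SubsetSeries ι) : a * b = b * a := by
  refine ext_apply fun S => ?_
  rw [mul_apply, mul_apply]
  refine Finset.sum_bij' (fun T _ => S \ T) (fun T _ => S \ T) ?_ ?_ ?_ ?_ ?_ <;>
    simp +contextual [mul_comm]

theorem mul_assoc' (a b c : SubsetSeries ι) : a * b * c = a * (b * c) := by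
  refine ext_apply fun S => ?_
  simp only [mul_apply, Finset.sum_mul, Finset.mul_sum]
  rw [Finset.sum_sigma', Finset.sum_sigma']
  refine Finset.sum_bij' (fun x _ => ⟨x.2, x.1 \ x.2⟩) (fun x _ => ⟨x.1 ∪ x.2, x.1⟩) ?_ ?_ ?_ ?_ ?_
  · rintro ⟨T, U⟩ h
    simp only [Finset.mem_sigma, Finset.mem_powerset] at h ⊢
    exact ⟨h.2.trans h.1, Finset.sdiff_subset_sdiff h.1 subset_rfl⟩
  · rintro ⟨U, V⟩ h
    simp only [Finset.mem_sigma, Finset.mem_powerset] at h ⊢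
    exact ⟨Finset.union_subset h.1 (h.2.trans Finset.sdiff_subset), Finset.subset_union_left⟩
  · rintro ⟨T, U⟩ h
    simp only [Finset.mem_sigma, Finset.mem_powerset] at h ⊢
    simp [Finset.union_eq_right.2 h.2]
  · rintro ⟨U, V⟩ h
    simp only [Finset.mem_sigma, Finset.mem_powerset] at h ⊢
    have : Disjoint V U := (Finset.subset_sdiff.1 h.2).2
    simp [Finset.union_sdiff_left, Finset.sdiff_eq_self_of_disjoint this]
  · rintro ⟨T, U⟩ h
    simp only [Finset.mem_sigma, Finset.mem_powerset] at h ⊢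
    have : (S \ U) \ (T \ U) = S \ T := by grind
    rw [this, mul_assoc]

theorem one_mul' (a : SubsetSeries ι) : 1 * a = a := by
  refine ext_apply fun S => ?_
  rw [mul_apply, Finset.sum_eq_single ∅]
  · simp [one_apply]
  · intro T _ hT
    simp [one_apply, hT]
  · simp

theorem mul_add' (a b c : SubsetSeries ι) : a * (b + c) = a * b + a * c := by
  refine ext_apply fun S => ?_
  simp [mul_apply, mul_add, Finset.sum_add_distrib]

instance : CommRing (SubsetSeries ι) where
  mul_comm := mul_comm'
  mul_assoc := mul_assoc'
  one_mul := one_mul'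
  mul_one a := by rw [mul_comm', one_mul']
  left_distrib := mul_add'
  right_distrib a b c := by rw [mul_comm', mul_add', mul_comm' c, mul_comm' c]
  zero_mul a := ext_apply fun S => by simp [mul_apply]
  mul_zero a := ext_apply fun S => by simp [mul_apply]
  zsmul := zsmulRec
  neg_add_cancel := neg_add_cancel

theorem sum_apply {κ : Type*} (s : Finset κ) (a : κ → SubsetSeries ι) (S : Finset ι) :
    (∑ i ∈ s, a i) S = ∑ i ∈ s, a i S :=
  map_sum (AddMonoidHom.mk' (fun a : SubsetSeries ι => a S) fun _ _ => rfl) a s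

@[simp] theorem mul_apply_empty (a b : SubsetSeries ι) : (a * b) ∅ = a ∅ * b ∅ := by
  simp [mul_apply]

@[simp] theorem one_apply_empty : (1 : SubsetSeries ι) ∅ = 1 := by
  simp [one_apply]

theorem neg_one_pow_mul_apply (n : ℕ) (a : SubsetSeries ι) (S : Finset ι) :
    ((-1) ^ n * a) S = (-1) ^ n * a S := by
  rcases n.even_or_odd with hn | hn <;> simp [hn.neg_one_pow]

theorem natCast_mul_apply (n : ℕ) (a : SubsetSeries ι) (S : Finset ι) :
    ((n : SubsetSeries ι) * a) S = n * a S := by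
  induction n with
  | zero => simp
  | succ n ih => simp [add_mul, ih]

/-- In the coefficient of `x * a` at `S`, every term except `x S * a ∅` involves `x` on a proper
subset, so induction on `S` applies. This replaces division by `a`. -/
theorem eq_zero_of_mul_eq_zero {a x : SubsetSeries ι} (ha : a ∅ = 1) (h : x * a = 0) : x = 0 := by
  refine ext_apply fun S => ?_
  induction S using Finset.strongInduction with
  | H S ih =>
    have hS : (x * a) S = 0 := by rw [h]; rfl
    rw [mul_apply, Finset.sum_eq_single S] at hS
    · simpa [ha] using hS
    · intro T hT hne
      rw [ih T ((Finset.mem_powerset.1 hT).ssubset_of_ne hne)]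
      simp
    · simp

/-- A factor without constant term uses up at least one element of `S`, so it raises the order of
vanishing by one. -/
theorem mul_apply_eq_zero {a b : SubsetSeries ι} {n : ℕ} (ha : a ∅ = 0)
    (hb : ∀ S : Finset ι, S.card ≤ n → b S = 0) (S : Finset ι) (hS : S.card ≤ n + 1) :
    (a * b) S = 0 := by
  rw [mul_apply]
  refine Finset.sum_eq_zero fun T hT => ?_
  rcases T.eq_empty_or_nonempty with rfl | hne
  · simp [ha]
  · have h1 := Finset.card_sdiff_add_card_eq_card (Finset.mem_powerset.1 hT)
    have h2 := hne.card_pos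
    rw [hb _ (by omega), mul_zero]

theorem pow_apply_eq_zero {a : SubsetSeries ι} (ha : a ∅ = 0) (n : ℕ) (S : Finset ι)
    (hS : S.card ≤ n) : (a ^ (n + 1)) S = 0 := by
  induction n generalizing S with
  | zero =>
    rw [Finset.card_eq_zero.1 (Nat.le_zero.1 hS)]
    simpa using ha
  | succ n ih =>
    rw [pow_succ']
    exact mul_apply_eq_zero ha ih S hS

/-- The Euler derivation `t r * ∂ / ∂ t r`. -/
def mark (r : ι) (a : SubsetSeries ι) : SubsetSeries ι :=
  ⟨fun S => if r ∈ S then a S else 0⟩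

theorem mark_apply (r : ι) (a : SubsetSeries ι) (S : Finset ι) :
    mark r a S = if r ∈ S then a S else 0 := rfl

theorem mark_add (r : ι) (a b : SubsetSeries ι) : mark r (a + b) = mark r a + mark r b := by
  refine ext_apply fun S => ?_
  by_cases h : r ∈ S <;> simp [mark_apply, h]

theorem mark_one (r : ι) : mark r (1 : SubsetSeries ι) = 0 := by
  refine ext_apply fun S => ?_
  rw [mark_apply, one_apply]
  split_ifs with h h' <;> simp_all

/-- The Leibniz rule: for `r ∈ S`, the element `r` lies in exactly one of `T` and `S \ T`. -/
theorem mark_mul (r : ι) (a b : SubsetSeries ι) :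
    mark r (a * b) = mark r a * b + a * mark r b := by
  refine ext_apply fun S => ?_
  simp only [mark_apply, add_apply, mul_apply, ← Finset.sum_add_distrib, Finset.mem_sdiff]
  split_ifs with h
  · refine Finset.sum_congr rfl fun T _ => ?_
    by_cases hT : r ∈ T <;> simp [hT, h]
  · refine (Finset.sum_eq_zero fun T hT => ?_).symm
    have : r ∉ T := fun h' => h (Finset.mem_powerset.1 hT h')
    simp [this, h]

theorem mark_pow_succ (r : ι) (a : SubsetSeries ι) (n : ℕ) :
    mark r (a ^ (n + 1)) = (n + 1 : ℕ) * (mark r a * a ^ n) := by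
  induction n with
  | zero => simp
  | succ n ih =>
    rw [pow_succ, mark_mul, ih]
    push_cast
    ring

theorem ext_mark {a b : SubsetSeries ι} (h₀ : a ∅ = b ∅) (h : ∀ r, mark r a = mark r b) :
    a = b := by
  refine ext_apply fun S => ?_
  rcases S.eq_empty_or_nonempty with rfl | ⟨r, hr⟩
  · exact h₀
  · have := congr_apply (h r) S
    simpa [mark_apply, hr] using this

/-- The multilinear part of `exp (∑ r, y r * t r)`. -/
def expLinear (y : ι → ℝ) : SubsetSeries ι := ⟨fun S => ∏ r ∈ S, y r⟩

theorem expLinear_add (y z : ι → ℝ) : expLinear (y + z) = expLinear y * expLinear z := by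
  refine ext_apply fun S => ?_
  simp [expLinear, mul_apply, Finset.prod_add]

theorem expLinear_zero : expLinear (0 : ι → ℝ) = 1 := by
  refine ext_apply fun S => ?_
  rw [one_apply]
  split_ifs with h
  · simp [expLinear, h]
  · obtain ⟨r, hr⟩ := Finset.nonempty_iff_ne_empty.2 h
    exact Finset.prod_eq_zero hr rfl

theorem expLinear_sum {κ : Type*} (s : Finset κ) (y : κ → ι → ℝ) :
    expLinear (∑ i ∈ s, y i) = ∏ i ∈ s, expLinear (y i) := by
  classical
  induction s using Finset.induction_on with
  | empty => simp [expLinear_zero]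
  | insert i s hi ih => rw [Finset.sum_insert hi, Finset.prod_insert hi, expLinear_add, ih]

end SubsetSeries

/-! ### Set partitions, split according to the block of one element. -/

namespace Finpartition

variable {ι : Type*} [DecidableEq ι]

/-- A sum over the partitions of `S` is organised by the block that contains a given element. -/
theorem sum_parts_eq_sum_block {S : Finset ι} {r : ι} (hr : r ∈ S)
    (F : Finset (Finset ι) → ℝ) :
    ∑ P : Finpartition S, F P.parts =
      ∑ B ∈ S.powerset with r ∈ B, ∑ Q : Finpartition (S \ B), F (insert B Q.parts) := by
  rw [Finset.sum_sigma']
  symm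
  have hcond : ∀ x ∈ (S.powerset.filter (r ∈ ·)).sigma
      (fun B => (Finset.univ : Finset (Finpartition (S \ B)))), x.1 ⊆ S ∧ r ∈ x.1 := by
    intro x hx
    simpa using hx
  have hnot : ∀ x ∈ (S.powerset.filter (r ∈ ·)).sigma
      (fun B => (Finset.univ : Finset (Finpartition (S \ B)))), ∀ C ∈ x.2.parts, r ∉ C := by
    intro x hx C hC h
    have := x.2.le hC h
    simp only [Finset.mem_sdiff] at this
    exact this.2 (hcond x hx).2
  refine Finset.sum_bij (fun x hx => x.2.extend (c := S)
    (Finset.nonempty_iff_ne_empty.1 ⟨r, (hcond x hx).2⟩) Finset.sdiff_disjoint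
    (Finset.sdiff_union_of_subset (hcond x hx).1)) ?_ ?_ ?_ ?_
  · simp
  · intro x hx y hy h
    have hp : insert x.1 x.2.parts = insert y.1 y.2.parts := congrArg Finpartition.parts h
    have hxy : x.1 = y.1 := by
      have : x.1 ∈ insert y.1 y.2.parts := hp ▸ Finset.mem_insert_self _ _
      rcases Finset.mem_insert.1 this with h | h
      · exact h
      · exact absurd (hcond x hx).2 (hnot y hy _ h)
    obtain ⟨B, Q⟩ := x
    obtain ⟨B', Q'⟩ := y
    obtain rfl : B = B' := hxy
    have h1 : B ∉ Q.parts := fun h => hnot _ hx _ h (hcond _ hx).2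
    have h2 : B ∉ Q'.parts := fun h => hnot _ hy _ h (hcond _ hy).2
    have : Q.parts = Q'.parts := by
      rw [← Finset.erase_insert h1, ← Finset.erase_insert h2]
      exact congrArg (Finset.erase · B) hp
    rw [Finpartition.ext this]
  · intro P _
    have hmem : P.part r ∈ P.parts := P.part_mem.2 hr
    refine ⟨⟨P.part r, P.ofSubset (Finset.erase_subset (P.part r) P.parts) ?_⟩, ?_, ?_⟩
    · have h := P.sup_parts
      have hd : Disjoint ((P.parts.erase (P.part r)).sup id) (P.part r) :=
        (P.supIndep (Finset.erase_subset _ _) hmem (Finset.notMem_erase _ _)).symm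
      rw [← Finset.insert_erase hmem, Finset.sup_insert] at h
      simp only [id_eq, Finset.sup_eq_union] at h
      calc (P.parts.erase (P.part r)).sup id
          = (P.part r ∪ (P.parts.erase (P.part r)).sup id) \ P.part r := by
            rw [Finset.union_sdiff_left, Finset.sdiff_eq_self_of_disjoint hd]
        _ = S \ P.part r := congrArg (· \ P.part r) h
    · simp [P.part_subset, P.mem_part hr]
    · apply Finpartition.ext
      exact Finset.insert_erase hmem
  · intro x _
    rfl

theorem notMem_parts_sdiff {S B : Finset ι} {r : ι} (hr : r ∈ B) (Q : Finpartition (S \ B)) :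
    B ∉ Q.parts := fun h => by
  have := Q.le h hr
  simp [hr] at this

end Finpartition

/-! ### Exponential and logarithm as sums over set partitions. -/

namespace SubsetSeries

variable {ι : Type*} [DecidableEq ι]

/-- `∑ P, g |P| * ∏ B ∈ P, a B` over the partitions `P` of the argument: the composition of the
exponential generating function of `g` with the part of `a` without constant term. -/
def partitionSum (g : ℕ → ℝ) (a : SubsetSeries ι) : SubsetSeries ι :=
  ⟨fun S => ∑ P : Finpartition S, g P.parts.card * ∏ B ∈ P.parts, a B⟩

theorem partitionSum_apply (g : ℕ → ℝ) (a : SubsetSeries ι) (S : Finset ι) :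
    partitionSum g a S = ∑ P : Finpartition S, g P.parts.card * ∏ B ∈ P.parts, a B := rfl

@[simp] theorem partitionSum_empty (g : ℕ → ℝ) (a : SubsetSeries ι) :
    partitionSum g a ∅ = g 0 := by
  have h : ∀ P : Finpartition (∅ : Finset ι), P.parts = ∅ := fun P =>
    P.parts_eq_empty_iff.2 rfl
  have : Unique (Finpartition (∅ : Finset ι)) := inferInstanceAs (Unique (Finpartition ⊥))
  rw [partitionSum_apply, Fintype.sum_unique, h]
  simp

/-- The chain rule: singling out the block that contains `r` leaves a partition with one block
fewer, and the shift of `g` is the derivative of its exponential generating function. -/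
theorem mark_partitionSum (r : ι) (g : ℕ → ℝ) (a : SubsetSeries ι) :
    mark r (partitionSum g a) = mark r a * partitionSum (fun k => g (k + 1)) a := by
  refine ext_apply fun S => ?_
  simp only [mark_apply, mul_apply]
  split_ifs with hr
  · rw [partitionSum_apply,
      Finpartition.sum_parts_eq_sum_block hr fun p => g p.card * ∏ B ∈ p, a B, Finset.sum_filter]
    refine Finset.sum_congr rfl fun B _ => ?_
    split_ifs with hB
    · rw [partitionSum_apply, Finset.mul_sum]
      refine Finset.sum_congr rfl fun Q _ => ?_
      have := Finpartition.notMem_parts_sdiff hB Q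
      rw [Finset.card_insert_of_notMem this, Finset.prod_insert this]
      ring
    · simp
  · refine (Finset.sum_eq_zero fun T hT => ?_).symm
    have : r ∉ T := fun h' => hr (Finset.mem_powerset.1 hT h')
    simp [this]

/-- The exponential: `∑ P, ∏ B ∈ P, κ B`. -/
def partitionExp (κ : SubsetSeries ι) : SubsetSeries ι := partitionSum (fun _ => 1) κ

theorem partitionExp_apply (κ : SubsetSeries ι) (S : Finset ι) :
    partitionExp κ S = ∑ P : Finpartition S, ∏ B ∈ P.parts, κ B := by
  simp [partitionExp, partitionSum_apply]

/-- Uniqueness for the differential equation of the exponential. Only sets `T` containing `r`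
contribute to the right-hand side, so it involves `a` on proper subsets of `S` only and determines
`a` recursively. -/
theorem eq_partitionExp {κ a : SubsetSeries ι} (h₀ : a ∅ = 1)
    (h : ∀ r, mark r a = mark r κ * a) : a = partitionExp κ := by
  refine ext_apply fun S => ?_
  induction S using Finset.strongInduction with
  | H S ih =>
    rcases S.eq_empty_or_nonempty with rfl | ⟨r, hr⟩
    · simp [partitionExp, h₀]
    · have h1 := congr_apply (h r) S
      have h2 := congr_apply (mark_partitionSum r (fun _ => 1) κ) S
      rw [mark_apply, if_pos hr, mul_apply] at h1 h2
      rw [partitionExp, h1, h2]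
      refine Finset.sum_congr rfl fun T hT => ?_
      by_cases hrT : r ∈ T
      · rw [ih (S \ T) (Finset.sdiff_ssubset (Finset.mem_powerset.1 hT) ⟨r, hrT⟩)]
        rfl
      · simp [mark_apply, hrT]

theorem partitionExp_add (κ κ' : SubsetSeries ι) :
    partitionExp (κ + κ') = partitionExp κ * partitionExp κ' := by
  refine (eq_partitionExp (by simp [partitionExp]) fun r => ?_).symm
  simp only [partitionExp, mark_mul, mark_partitionSum, mark_add]
  ring

/-- Subtracting 1 removes the constant term, so the `n`-th power runs over ordered partitions into
`n` nonempty blocks, each partition being counted `n!` times. The proof compares derivatives instead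
of counting. -/
theorem factorial_mul_partitionSum_single {a : SubsetSeries ι} (ha : a ∅ = 1) (n : ℕ) :
    (n.factorial : SubsetSeries ι) * partitionSum (Pi.single n 1) a = (a - 1) ^ n := by
  induction n with
  | zero =>
    refine ext_mark (by simp) fun r => ?_
    have : (fun k => (Pi.single 0 1 : ℕ → ℝ) (k + 1)) = 0 := by
      ext k
      simp
    simp only [Nat.factorial_zero, Nat.cast_one, one_mul, mark_partitionSum, pow_zero, mark_one,
      this]
    have : partitionSum 0 a = 0 := by
      refine ext_apply fun S => ?_
      simp [partitionSum_apply]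
    rw [this, mul_zero]
  | succ n ih =>
    have hs : (fun k => (Pi.single (n + 1) 1 : ℕ → ℝ) (k + 1)) = Pi.single n 1 := by
      ext k
      simp [Pi.single_apply]
    have hcast : ∀ (k : ℕ) (r : ι) (b : SubsetSeries ι),
        mark r ((k : SubsetSeries ι) * b) = k * mark r b := by
      intro k r b
      refine ext_apply fun S => ?_
      by_cases h : r ∈ S <;> simp [mark_apply, natCast_mul_apply, h]
    have hsub : ∀ r, mark r (a - 1) = mark r a := fun r => by
      have := mark_add r (a - 1) 1
      rw [sub_add_cancel, mark_one, add_zero] at this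
      exact this.symm
    refine ext_mark ?_ fun r => ?_
    · simp [pow_succ, ha]
    · rw [hcast, mark_partitionSum, hs, mark_pow_succ, hsub, ← ih, Nat.factorial_succ]
      push_cast
      ring

/-- The weights (-1)^k k! have exponential generating function 1/(1 + x); substituting `a - 1` gives
the inverse of `a` as a finite geometric series. -/
theorem partitionSum_neg_one_pow_mul_self [Fintype ι] {a : SubsetSeries ι} (ha : a ∅ = 1) :
    partitionSum (fun k => (-1) ^ k * (k.factorial : ℝ)) a * a = 1 := by
  have key : partitionSum (fun k => (-1) ^ k * (k.factorial : ℝ)) a =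
      ∑ k ∈ Finset.range (Fintype.card ι + 1), (-(a - 1)) ^ k := by
    refine ext_apply fun S => ?_
    rw [sum_apply]
    have : ∀ k ∈ Finset.range (Fintype.card ι + 1), ((-(a - 1)) ^ k) S =
        ∑ P : Finpartition S, (-1) ^ k * (k.factorial * ((Pi.single k 1 : ℕ → ℝ) P.parts.card *
          ∏ B ∈ P.parts, a B)) := by
      intro k _
      rw [neg_pow, neg_one_pow_mul_apply, ← factorial_mul_partitionSum_single ha,
        natCast_mul_apply, partitionSum_apply, Finset.mul_sum, Finset.mul_sum]
    rw [Finset.sum_congr rfl this, Finset.sum_comm, partitionSum_apply]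
    refine Finset.sum_congr rfl fun P _ => ?_
    rw [Finset.sum_eq_single P.parts.card]
    · simp [mul_assoc]
    · intro k _ hk
      simp [hk.symm]
    · intro h
      -- The truncated range contains every possible number of blocks, as a partition has at most
      -- `Fintype.card ι` of them.
      have h1 := P.card_parts_le_card
      have h2 := S.card_le_univ
      simp only [Finset.mem_range] at h
      omega
  have hnil : (-(a - 1)) ^ (Fintype.card ι + 1) = 0 := by
    refine ext_apply fun S => ?_
    exact pow_apply_eq_zero (by simp [ha]) _ S S.card_le_univ
  have hg := mul_neg_geom_sum (-(a - 1)) (Fintype.card ι + 1)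
  rw [hnil] at hg
  rw [key]
  linear_combination hg

/-- The joint cumulants of the moments `a` have exponential `a`. -/
theorem partitionExp_partitionSum_log [Fintype ι] {a : SubsetSeries ι} (ha : a ∅ = 1) :
    partitionExp (partitionSum (fun k => (-1) ^ (k - 1) * ((k - 1).factorial : ℝ)) a) = a := by
  refine (eq_partitionExp ha fun r => ?_).symm
  rw [mark_partitionSum]
  simp only [Nat.add_sub_cancel]
  rw [mul_assoc, partitionSum_neg_one_pow_mul_self ha, mul_one]

/-- This is exp(log b - log a) · a = b: differences of cumulants exponentiate to a ratio of moment
generating functions. -/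
theorem partitionExp_sub_mul [Fintype ι] {a b : SubsetSeries ι} (ha : a ∅ = 1) (hb : b ∅ = 1) :
    partitionExp (partitionSum (fun k => (-1) ^ (k - 1) * ((k - 1).factorial : ℝ)) b -
      partitionSum (fun k => (-1) ^ (k - 1) * ((k - 1).factorial : ℝ)) a) * a = b := by
  nth_rw 2 [← partitionExp_partitionSum_log ha]
  rw [← partitionExp_add, sub_add_cancel, partitionExp_partitionSum_log hb]

open Classical in
/-- The sequences of `n` disjoint sets with union `S`. -/
noncomputable def orderedPartitions [Fintype ι] (n : ℕ) (S : Finset ι) :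
    Finset (Fin n → Finset ι) :=
  Finset.univ.filter fun g => Pairwise (Function.onFun Disjoint g) ∧ Finset.univ.biUnion g = S

theorem mem_orderedPartitions [Fintype ι] {n : ℕ} {S : Finset ι} {g : Fin n → Finset ι} :
    g ∈ orderedPartitions n S ↔
      Pairwise (Function.onFun Disjoint g) ∧ Finset.univ.biUnion g = S := by
  simp [orderedPartitions]

theorem cons_mem_orderedPartitions [Fintype ι] {n : ℕ} {S B : Finset ι} {g : Fin n → Finset ι} :
    (Fin.cons B g : Fin (n + 1) → Finset ι) ∈ orderedPartitions (n + 1) S ↔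
      B ⊆ S ∧ g ∈ orderedPartitions n (S \ B) := by
  have hU : Finset.univ.biUnion (Fin.cons B g : Fin (n + 1) → Finset ι) =
      B ∪ Finset.univ.biUnion g := by
    ext r
    simp [Fin.exists_fin_succ]
  rw [mem_orderedPartitions, mem_orderedPartitions, hU]
  constructor
  · rintro ⟨hd, hS⟩
    have h0 : Disjoint B (Finset.univ.biUnion g) := by
      rw [Finset.disjoint_biUnion_right]
      intro i _
      simpa [Function.onFun] using hd (i := 0) (j := i.succ) (Fin.succ_ne_zero i).symm
    refine ⟨hS ▸ Finset.subset_union_left, fun i j hij => ?_, ?_⟩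
    · simpa [Function.onFun] using hd (i := i.succ) (j := j.succ) (by simpa using hij)
    · rw [← hS, Finset.union_sdiff_left, Finset.sdiff_eq_self_of_disjoint h0.symm]
  · rintro ⟨hB, hd, hS⟩
    have h0 : ∀ i, Disjoint B (g i) := fun i => by
      have : g i ⊆ S \ B := hS ▸ Finset.subset_biUnion_of_mem g (Finset.mem_univ i)
      exact (Finset.subset_sdiff.1 this).2.symm
    refine ⟨fun i j hij => ?_, by rw [hS, Finset.union_sdiff_of_subset hB]⟩
    induction i using Fin.cases with
    | zero =>
      induction j using Fin.cases with
      | zero => exact absurd rfl hij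
      | succ j => simpa [Function.onFun] using h0 j
    | succ i =>
      induction j using Fin.cases with
      | zero => simpa [Function.onFun] using (h0 i).symm
      | succ j => simpa [Function.onFun] using hd (i := i) (j := j) (by simpa using hij)

theorem prod_apply [Fintype ι] {n : ℕ} (a : Fin n → SubsetSeries ι) (S : Finset ι) :
    (∏ i, a i) S = ∑ g ∈ orderedPartitions n S, ∏ i, a i (g i) := by
  induction n generalizing S with
  | zero =>
    simp only [Finset.univ_eq_empty, Finset.prod_empty, Finset.sum_const, nsmul_eq_mul, mul_one]
    rw [one_apply, orderedPartitions]
    by_cases h : S = ∅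
    · subst h
      simp [Pairwise]
    · simp [h, Ne.symm h]
  | succ n ih =>
    rw [Fin.prod_univ_succ, mul_apply]
    simp only [ih, Finset.mul_sum]
    rw [Finset.sum_sigma']
    refine Finset.sum_bij' (fun x _ => Fin.cons x.1 x.2) (fun g _ => ⟨g 0, Fin.tail g⟩)
      ?_ ?_ ?_ ?_ ?_
    · intro x hx
      rw [cons_mem_orderedPartitions]
      simpa using hx
    · intro g hg
      rw [← Fin.cons_self_tail g, cons_mem_orderedPartitions] at hg
      simpa using hg
    · simp
    · simp
    · intro x _
      simp [Fin.prod_univ_succ]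

end SubsetSeries

/-! ### Path sums, Neumann series and ratios of consecutive principal minors. -/

section PathSum

variable {R : Type*} [CommRing R]

/-- The sum of the weights of the paths from `c` to `d` with `q` intermediate vertices in
`{0, …, m - 1}`, a step from `j` to `k` having weight `A k j`. -/
def pathSum (A : ℕ → ℕ → R) (m q c d : ℕ) : R :=
  ∑ κ : Fin q → Fin m,
    (∏ i : Fin q, A ((Fin.cons c (fun i => (κ i : ℕ)) : Fin (q + 1) → ℕ) i.succ)
      ((Fin.cons c (fun i => (κ i : ℕ)) : Fin (q + 1) → ℕ) i.castSucc)) *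
      A d ((Fin.cons c (fun i => (κ i : ℕ)) : Fin (q + 1) → ℕ) (Fin.last q))

theorem pathSum_zero (A : ℕ → ℕ → R) (m c d : ℕ) : pathSum A m 0 c d = A d c := by
  simp [pathSum]

theorem pathSum_succ (A : ℕ → ℕ → R) (m q c d : ℕ) :
    pathSum A m (q + 1) c d = ∑ j : Fin m, A j c * pathSum A m q j d := by
  simp only [pathSum]
  rw [← (Fin.consEquiv fun _ : Fin (q + 1) => Fin m).sum_comp, Fintype.sum_prod_type]
  refine Finset.sum_congr rfl fun j _ => ?_
  rw [Finset.mul_sum]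
  refine Finset.sum_congr rfl fun κ _ => ?_
  have h : (fun i => ((Fin.consEquiv (fun _ : Fin (q + 1) => Fin m) (j, κ)) i : ℕ)) =
      (Fin.cons (j : ℕ) (fun i => (κ i : ℕ)) : Fin (q + 1) → ℕ) := by
    ext i
    induction i using Fin.cases <;> simp [Fin.consEquiv]
  rw [h, Fin.prod_univ_succ, ← Fin.succ_last, Fin.cons_succ, mul_assoc]
  simp

/-- The alternating sum of the path sums over all numbers of intermediate vertices below `N`. -/
def signedPathSum (A : ℕ → ℕ → R) (m N c d : ℕ) : R :=
  ∑ q ∈ Finset.range N, (-1) ^ q * pathSum A m q c d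

/-- Multiplying by `A` prepends a step, so the two alternating sums telescope down to the
single-step path. With Z the matrix of signed path sums this is Z + AZ = A; the truncation is exact
by `hN`. -/
theorem signedPathSum_add_sum {A : ℕ → ℕ → R} {m N c d : ℕ}
    (hN : pathSum A m N c d = 0) :
    signedPathSum A m N c d + ∑ j : Fin m, A j c * signedPathSum A m N j d = A d c := by
  have h1 : ∑ j : Fin m, A j c * signedPathSum A m N j d =
      ∑ q ∈ Finset.range N, (-1) ^ q * pathSum A m (q + 1) c d := by
    simp only [signedPathSum, pathSum_succ, Finset.mul_sum]
    rw [Finset.sum_comm]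
    refine Finset.sum_congr rfl fun q _ => Finset.sum_congr rfl fun j _ => ?_
    ring
  have h2 : signedPathSum A m N c d = ∑ q ∈ Finset.range (N + 1), (-1) ^ q * pathSum A m q c d := by
    rw [Finset.sum_range_succ, hN, mul_zero, add_zero, signedPathSum]
  rw [h1, h2, Finset.sum_range_succ', pathSum_zero, add_right_comm, ← Finset.sum_add_distrib]
  simp [pow_succ]

/-- The leading principal minors of `1 + A`. -/
def leadingMinor (A : ℕ → ℕ → R) (n : ℕ) : R :=
  (1 + Matrix.of fun j k : Fin n => A j k).det

/-- The Schur complement of the leading block, in a form free of division: the path sums solve the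
linear system that clears the last column by a unipotent column operation. -/
theorem leadingMinor_succ_eq_mul {A : ℕ → ℕ → R} (hA : ∀ j k, A j k = A k j) {m N : ℕ}
    (hN : ∀ c ≤ m, pathSum A m N c m = 0) :
    (1 + signedPathSum A m N m m) * leadingMinor A m = leadingMinor A (m + 1) := by
  set Z := fun c => signedPathSum A m N c m with hZ
  -- The equations with `c < m` clear the last column; the one with `c = m` gives the new corner
  -- entry.
  have hz : ∀ c ≤ m, Z c + ∑ j : Fin m, A j c * Z j = A m c := fun c hc =>
    signedPathSum_add_sum (hN c hc)
  have hU : (Matrix.fromBlocks (1 : Matrix (Fin m) (Fin m) R)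
      (Matrix.of fun (j : Fin m) (_ : Unit) => -Z j) 0 (1 : Matrix Unit Unit R)).det = 1 := by
    rw [Matrix.det_fromBlocks_zero₂₁]
    simp
  have hblock : leadingMinor A (m + 1) = (Matrix.fromBlocks
      (1 + Matrix.of fun j k : Fin m => A j k) (Matrix.of fun (j : Fin m) (_ : Unit) => A j m)
      (Matrix.of fun (_ : Unit) (k : Fin m) => A m k)
      (Matrix.of fun (_ _ : Unit) => 1 + A m m)).det := by
    rw [leadingMinor, ← Matrix.det_submatrix_equiv_self
      ((Equiv.sumCongr (Equiv.refl (Fin m)) (Equiv.ofUnique Unit (Fin 1))).trans finSumFinEquiv)]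
    congr 1
    ext x y
    rcases x with j | _ <;> rcases y with k | _
    · simp [Matrix.one_apply, Fin.ext_iff]
    · simp [Fin.ext_iff, j.2.ne]
    · simp [Fin.ext_iff, k.2.ne']
    · simp
  have hmul : Matrix.fromBlocks
      (1 + Matrix.of fun j k : Fin m => A j k) (Matrix.of fun (j : Fin m) (_ : Unit) => A j m)
      (Matrix.of fun (_ : Unit) (k : Fin m) => A m k)
      (Matrix.of fun (_ _ : Unit) => 1 + A m m) *
      Matrix.fromBlocks (1 : Matrix (Fin m) (Fin m) R)
      (Matrix.of fun (j : Fin m) (_ : Unit) => -Z j) 0 (1 : Matrix Unit Unit R) =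
      Matrix.fromBlocks (1 + Matrix.of fun j k : Fin m => A j k) 0
      (Matrix.of fun (_ : Unit) (k : Fin m) => A m k)
      (Matrix.of fun (_ _ : Unit) => 1 + Z m) := by
    rw [Matrix.fromBlocks_multiply]
    congr 1
    · simp
    · ext j u
      have := hz j j.2.le
      simp only [Matrix.add_mul, Matrix.one_mul, Matrix.mul_one, Matrix.add_apply, Matrix.mul_apply,
        Matrix.of_apply, Matrix.zero_apply, hA j m, ← this, mul_neg, Finset.sum_neg_distrib,
        hA j]
      ring
    · simp
    · ext u v
      have := hz m le_rfl
      simp only [Matrix.mul_one, Matrix.add_apply, Matrix.mul_apply,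
        Matrix.of_apply, hA m, mul_neg, Finset.sum_neg_distrib] at this ⊢
      rw [← this]
      ring
  have hdet := congrArg Matrix.det hmul
  rw [Matrix.det_mul, hU, mul_one, Matrix.det_fromBlocks_zero₁₂, ← hblock,
    Matrix.det_unique (n := Unit)] at hdet
  rw [hdet, leadingMinor, mul_comm]
  rfl

/-- Here the base point is itself an allowed intermediate vertex, so `1 - Z` is the full inverse of
`1 + A`. Its last diagonal entry is a ratio of minors by Cramer's rule. -/
theorem leadingMinor_mul_one_sub {A : ℕ → ℕ → R} (hA : ∀ j k, A j k = A k j) {m N : ℕ}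
    (hN : ∀ c d, pathSum A (m + 1) N c d = 0) :
    (1 - signedPathSum A (m + 1) N m m) * leadingMinor A (m + 1) = leadingMinor A m := by
  set M : Matrix (Fin (m + 1)) (Fin (m + 1)) R :=
    1 + Matrix.of fun j k : Fin (m + 1) => A j k with hM
  set Z : Matrix (Fin (m + 1)) (Fin (m + 1)) R :=
    Matrix.of fun c d => signedPathSum A (m + 1) N c d with hZ
  have h1 : M * (1 - Z) = 1 := by
    have : Z + (Matrix.of fun j k : Fin (m + 1) => A j k) * Z =
        Matrix.of fun j k : Fin (m + 1) => A j k := by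
      ext c d
      have := signedPathSum_add_sum (hN c d)
      simp only [Matrix.add_apply, Matrix.mul_apply, hZ, Matrix.of_apply]
      rw [hA c d, ← this]
      simp [hA c]
    rw [mul_sub, hM, add_mul (1 : Matrix (Fin (m + 1)) (Fin (m + 1)) R) _ Z, one_mul, this]
    simp
  -- The adjugate form of Cramer's rule, valid over any commutative ring.
  have h2 : M.det • (1 - Z) = M.adjugate := by
    rw [← Matrix.one_mul (1 - Z), ← Matrix.smul_mul, ← Matrix.adjugate_mul, Matrix.mul_assoc, h1,
      Matrix.mul_one]
  have h3 := congrFun (congrFun h2 (Fin.last m)) (Fin.last m)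
  rw [Matrix.adjugate_fin_succ_eq_det_submatrix] at h3
  have h4 : M.submatrix (Fin.last m).succAbove (Fin.last m).succAbove =
      1 + Matrix.of fun j k : Fin m => A j k := by
    ext j k
    simp [hM, Matrix.one_apply]
  rw [h4, Even.neg_one_pow ⟨_, rfl⟩, one_mul] at h3
  rw [leadingMinor, leadingMinor, ← h3, mul_comm]
  simp [hZ, hM]

end PathSum

namespace SubsetSeries

variable {ι : Type*} [DecidableEq ι]

/-- A path with `q` intermediate vertices has `q + 1` steps, each of which consumes an element of
`S`. -/
theorem pathSum_apply_eq_zero {A : ℕ → ℕ → SubsetSeries ι} (hA : ∀ j k, A j k ∅ = 0) (m q c d : ℕ)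
    (S : Finset ι) (hS : S.card ≤ q) : pathSum A m q c d S = 0 := by
  induction q generalizing c S with
  | zero => rw [pathSum_zero, Finset.card_eq_zero.1 (Nat.le_zero.1 hS), hA]
  | succ q ih =>
    rw [pathSum_succ, sum_apply]
    exact Finset.sum_eq_zero fun j _ => mul_apply_eq_zero (hA _ _) (ih j) S hS

theorem pathSum_card_eq_zero [Fintype ι] {A : ℕ → ℕ → SubsetSeries ι} (hA : ∀ j k, A j k ∅ = 0)
    (m c d : ℕ) : pathSum A m (Fintype.card ι) c d = 0 :=
  ext_apply fun S => pathSum_apply_eq_zero hA m _ c d S S.card_le_univ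

/-- Evaluation at `∅`, the constant term. -/
def constantTerm : SubsetSeries ι →+* ℝ where
  toFun a := a ∅
  map_one' := one_apply_empty
  map_mul' := mul_apply_empty
  map_zero' := rfl
  map_add' _ _ := rfl

theorem leadingMinor_apply_empty {A : ℕ → ℕ → SubsetSeries ι} (hA : ∀ j k, A j k ∅ = 0) (n : ℕ) :
    leadingMinor A n ∅ = 1 := by
  change constantTerm (leadingMinor A n) = 1
  rw [leadingMinor, RingHom.map_det]
  convert Matrix.det_one (n := Fin n) (R := ℝ)
  ext j k
  have : constantTerm (A j k) = 0 := hA j k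
  simp [Matrix.one_apply, this, apply_ite]

end SubsetSeries

/-! ### Orthonormality of the Laguerre functions and the determinantal form of the density. -/

namespace WishartLaguerre

open Polynomial

theorem weight_nonneg (α : ℝ) {x : ℝ} (hx : 0 ≤ x) : 0 ≤ weight α x :=
  mul_nonneg (Real.rpow_nonneg hx α) (Real.exp_pos _).le

theorem measurable_weight (α : ℝ) : Measurable (weight α) := by
  unfold weight
  fun_prop

theorem pow_mul_weight_eq (α : ℝ) (i : ℕ) {x : ℝ} (hx : x ∈ Set.Ioi (0 : ℝ)) :
    x ^ i * weight α x = Real.exp (-x) * x ^ (α + i + 1 - 1) := by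
  rw [weight, add_sub_cancel_right, Real.rpow_add hx, Real.rpow_natCast]
  ring

theorem integrableOn_pow_mul_weight {α : ℝ} (hα : 0 ≤ α) (i : ℕ) :
    IntegrableOn (fun x => x ^ i * weight α x) (Set.Ici 0) := by
  rw [integrableOn_Ici_iff_integrableOn_Ioi]
  exact (Real.GammaIntegral_convergent (s := α + i + 1) (by positivity)).congr_fun
    (fun x hx => (pow_mul_weight_eq α i hx).symm) measurableSet_Ioi

theorem integral_pow_mul_weight {α : ℝ} (hα : 0 ≤ α) (i : ℕ) :
    ∫ x in Set.Ici 0, x ^ i * weight α x = Real.Gamma (α + i + 1) := by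
  rw [integral_Ici_eq_integral_Ioi, Real.Gamma_eq_integral (by positivity)]
  exact setIntegral_congr_fun measurableSet_Ioi fun x hx => pow_mul_weight_eq α i hx

/-- The coefficient of `x ^ i` in the Laguerre polynomial `L_k^{(α)}`. -/
noncomputable def laguerreCoeff (α : ℝ) (k i : ℕ) : ℝ :=
  (-1) ^ i * (Real.Gamma (k + α + 1) / ((k - i).factorial * Real.Gamma (α + i + 1))) / i.factorial

theorem laguerre_eq_sum (α : ℝ) (k : ℕ) (x : ℝ) :
    laguerre α k x = ∑ i ∈ Finset.range (k + 1), laguerreCoeff α k i * x ^ i := by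
  refine Finset.sum_congr rfl fun i _ => ?_
  rw [laguerreCoeff]
  ring

theorem laguerreCoeff_self {α : ℝ} (hα : 0 ≤ α) (k : ℕ) :
    laguerreCoeff α k k = (-1) ^ k / k.factorial := by
  have : Real.Gamma (α + k + 1) ≠ 0 := (Real.Gamma_pos_of_pos (by positivity)).ne'
  rw [laguerreCoeff, add_comm (k : ℝ) α]
  simp [this]

theorem Gamma_add_natCast_eq {s : ℝ} (hs : 0 < s) (i : ℕ) :
    Real.Gamma (s + i) = Real.Gamma s * (ascPochhammer ℝ i).eval s := by
  induction i with
  | zero => simp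
  | succ i ih =>
    rw [ascPochhammer_succ_eval, ← mul_assoc, ← ih, Nat.cast_succ, ← add_assoc,
      Real.Gamma_add_one (by positivity), mul_comm]

/-- Up to sign the sum is the `k`-th forward difference of `p` at 0, which sees only the coefficient
of degree `k`. -/
theorem sum_neg_one_pow_mul_choose_mul_eval {k : ℕ} (p : ℝ[X]) (hp : p.natDegree ≤ k) :
    ∑ j ∈ Finset.range (k + 1), (-1) ^ j * (k.choose j : ℝ) * p.eval (j : ℝ) =
      (-1) ^ k * (p.coeff k * k.factorial) := by
  have h1 := fwdDiff_iter_eq_sum_shift (h := (1 : ℝ)) p.eval k 0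
  have h2 : (fwdDiff (1 : ℝ))^[k] p.eval 0 = p.coeff k * k.factorial := by
    rcases hp.lt_or_eq with h | rfl
    · rw [Polynomial.fwdDiff_iter_eq_zero_of_degree_lt h, coeff_eq_zero_of_natDegree_lt h]
      simp
    · rw [Polynomial.fwdDiff_iter_degree_eq_factorial]
      simp
  rw [← h2, h1, Finset.mul_sum]
  refine Finset.sum_congr rfl fun j hj => ?_
  have hj' : j ≤ k := Nat.lt_succ_iff.1 (Finset.mem_range.1 hj)
  obtain ⟨d, rfl⟩ := Nat.exists_eq_add_of_le hj'
  have : ((-1 : ℝ) ^ d) * (-1) ^ d = 1 := by rw [← mul_pow]; simp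
  simp only [Nat.add_sub_cancel_left, zsmul_eq_mul, zero_add, nsmul_eq_mul, mul_one, pow_add]
  push_cast
  linear_combination (-(-1) ^ j * ((j + d).choose j : ℝ) * p.eval (j : ℝ)) * this

/-- The quotient Γ(α + i + j + 1) / Γ(α + j + 1) is a monic polynomial of degree `i` in `j`, so the
sum is a `k`-th difference: it vanishes for `i < k` and is explicit for `i = k`. This is the
orthogonality of `L_k` to lower powers. -/
theorem sum_laguerreCoeff_mul_Gamma {α : ℝ} (hα : 0 ≤ α) {k i : ℕ} (hi : i ≤ k) :
    ∑ j ∈ Finset.range (k + 1), laguerreCoeff α k j * Real.Gamma (α + (i + j : ℕ) + 1) =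
      if i = k then (-1) ^ k * Real.Gamma (k + α + 1) else 0 := by
  set p : ℝ[X] := (ascPochhammer ℝ i).comp (X + C (α + 1)) with hp
  have hdeg : p.natDegree = i := by
    rw [hp, natDegree_comp, natDegree_X_add_C, mul_one, ascPochhammer_natDegree]
  have hmonic : p.Monic := (monic_ascPochhammer ℝ i).comp_X_add_C _
  have hcoeff : p.coeff k = if i = k then 1 else 0 := by
    split_ifs with h
    · rw [← h, ← hdeg]
      exact hmonic
    · exact coeff_eq_zero_of_natDegree_lt (by omega)
  have hsum := sum_neg_one_pow_mul_choose_mul_eval p (hdeg.trans_le hi)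
  have hk : (k.factorial : ℝ) ≠ 0 := by positivity
  have : ∑ j ∈ Finset.range (k + 1), laguerreCoeff α k j * Real.Gamma (α + (i + j : ℕ) + 1) =
      Real.Gamma (k + α + 1) / k.factorial *
        ∑ j ∈ Finset.range (k + 1), (-1) ^ j * (k.choose j : ℝ) * p.eval (j : ℝ) := by
    rw [Finset.mul_sum]
    refine Finset.sum_congr rfl fun j hj => ?_
    have hj' : j ≤ k := Nat.lt_succ_iff.1 (Finset.mem_range.1 hj)
    have hpos : 0 < α + j + 1 := by positivity
    have hG : Real.Gamma (α + (i + j : ℕ) + 1) = Real.Gamma (α + j + 1) * p.eval (j : ℝ) := by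
      rw [hp, eval_comp, eval_add, eval_X, eval_C,
        show (j : ℝ) + (α + 1) = α + j + 1 by ring, ← Gamma_add_natCast_eq hpos]
      push_cast
      ring_nf
    have hG0 := (Real.Gamma_pos_of_pos hpos).ne'
    rw [hG, laguerreCoeff, Nat.cast_choose ℝ hj']
    field_simp
  rw [this, hsum, hcoeff]
  split_ifs
  · field_simp
  · simp

theorem integrableOn_pow_mul_laguerre {α : ℝ} (hα : 0 ≤ α) (i k : ℕ) :
    IntegrableOn (fun x => x ^ i * laguerre α k x * weight α x) (Set.Ici 0) := by
  have : (fun x => x ^ i * laguerre α k x * weight α x) = fun x =>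
      ∑ j ∈ Finset.range (k + 1), laguerreCoeff α k j * (x ^ (i + j) * weight α x) := by
    ext x
    rw [laguerre_eq_sum, Finset.mul_sum, Finset.sum_mul]
    refine Finset.sum_congr rfl fun j _ => ?_
    ring
  rw [this]
  exact integrable_finsetSum _ fun j _ => (integrableOn_pow_mul_weight hα _).const_mul _

theorem integral_pow_mul_laguerre {α : ℝ} (hα : 0 ≤ α) {i k : ℕ} (hi : i ≤ k) :
    ∫ x in Set.Ici 0, x ^ i * laguerre α k x * weight α x =
      if i = k then (-1) ^ k * Real.Gamma (k + α + 1) else 0 := by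
  have : (fun x => x ^ i * laguerre α k x * weight α x) = fun x =>
      ∑ j ∈ Finset.range (k + 1), laguerreCoeff α k j * (x ^ (i + j) * weight α x) := by
    ext x
    rw [laguerre_eq_sum, Finset.mul_sum, Finset.sum_mul]
    refine Finset.sum_congr rfl fun j _ => ?_
    ring
  rw [this, integral_finsetSum _ fun j _ => (integrableOn_pow_mul_weight hα _).const_mul _,
    ← sum_laguerreCoeff_mul_Gamma hα hi]
  refine Finset.sum_congr rfl fun j _ => ?_
  rw [integral_const_mul, integral_pow_mul_weight hα]

theorem integral_laguerre_mul_laguerre_of_le {α : ℝ} (hα : 0 ≤ α) {j k : ℕ} (hjk : j ≤ k) :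
    ∫ x in Set.Ici 0, laguerre α j x * laguerre α k x * weight α x =
      if j = k then Real.Gamma (k + α + 1) / k.factorial else 0 := by
  have : (fun x => laguerre α j x * laguerre α k x * weight α x) = fun x =>
      ∑ i ∈ Finset.range (j + 1), laguerreCoeff α j i * (x ^ i * laguerre α k x * weight α x) := by
    ext x
    rw [laguerre_eq_sum α j, Finset.sum_mul, Finset.sum_mul]
    refine Finset.sum_congr rfl fun j _ => ?_
    ring
  rw [this, integral_finsetSum _ fun i _ => (integrableOn_pow_mul_laguerre hα i k).const_mul _]
  simp only [integral_const_mul]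
  have hle : ∀ i ∈ Finset.range (j + 1), laguerreCoeff α j i *
      ∫ x in Set.Ici 0, x ^ i * laguerre α k x * weight α x =
      if i = k then laguerreCoeff α j i * ((-1) ^ k * Real.Gamma (k + α + 1)) else 0 := by
    intro i hi
    rw [integral_pow_mul_laguerre hα ((Nat.lt_succ_iff.1 (Finset.mem_range.1 hi)).trans hjk)]
    split_ifs <;> simp
  rw [Finset.sum_congr rfl hle, Finset.sum_ite_eq']
  simp only [Finset.mem_range]
  by_cases h : j = k
  · subst h
    have : ((-1 : ℝ) ^ j) * (-1) ^ j = 1 := by rw [← mul_pow]; simp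
    simp only [lt_add_iff_pos_right, zero_lt_one, if_true, laguerreCoeff_self hα]
    rw [div_mul_eq_mul_div, ← mul_assoc, this, one_mul]
  · rw [if_neg h, if_neg (by omega)]

/-- The orthonormal functions `√(k! / (k + α)!) * √(w(x)) * L_k^{(α)}(x)`. -/
noncomputable def laguerreFun (α : ℝ) (k : ℕ) (x : ℝ) : ℝ :=
  Real.sqrt (k.factorial / Real.Gamma (k + α + 1)) * (Real.sqrt (weight α x) * laguerre α k x)

theorem normalization_pos {α : ℝ} (hα : 0 ≤ α) (k : ℕ) :
    0 < k.factorial / Real.Gamma (k + α + 1) :=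
  div_pos (by positivity) (Real.Gamma_pos_of_pos (by positivity))

theorem laguerreTerm_eq {α : ℝ} (hα : 0 ≤ α) (k : ℕ) {x y : ℝ} (hx : 0 ≤ x) :
    laguerreTerm α k x y = laguerreFun α k x * laguerreFun α k y := by
  have h := Real.mul_self_sqrt (normalization_pos hα k).le
  rw [laguerreTerm, laguerreFun, laguerreFun, Real.sqrt_mul (weight_nonneg α hx)]
  linear_combination (-(Real.sqrt (weight α x) * Real.sqrt (weight α y) * laguerre α k x *
    laguerre α k y)) * h

theorem laguerreFun_mul_laguerreFun (α : ℝ) (j k : ℕ) {x : ℝ} (hx : 0 ≤ x) :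
    laguerreFun α j x * laguerreFun α k x =
      Real.sqrt (j.factorial / Real.Gamma (j + α + 1)) *
      Real.sqrt (k.factorial / Real.Gamma (k + α + 1)) *
        (laguerre α j x * laguerre α k x * weight α x) := by
  have h := Real.mul_self_sqrt (weight_nonneg α hx)
  rw [laguerreFun, laguerreFun]
  linear_combination (Real.sqrt (j.factorial / Real.Gamma (j + α + 1)) *
      Real.sqrt (k.factorial / Real.Gamma (k + α + 1)) * laguerre α j x * laguerre α k x) * h

theorem integral_laguerreFun_mul {α : ℝ} (hα : 0 ≤ α) (j k : ℕ) :
    ∫ x in Set.Ici 0, laguerreFun α j x * laguerreFun α k x = if j = k then 1 else 0 := by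
  wlog hjk : j ≤ k generalizing j k
  · simp only [mul_comm (laguerreFun α j _), eq_comm (a := j)]
    exact this k j (le_of_not_ge hjk)
  rw [setIntegral_congr_fun measurableSet_Ici fun x hx => laguerreFun_mul_laguerreFun α j k hx,
    integral_const_mul, integral_laguerre_mul_laguerre_of_le hα hjk]
  split_ifs with h
  · subst h
    rw [Real.mul_self_sqrt (normalization_pos hα j).le, div_mul_div_comm, mul_comm]
    have := (Real.Gamma_pos_of_pos (show 0 < j + α + 1 by positivity)).ne'
    have hj : (j.factorial : ℝ) ≠ 0 := by positivity
    exact div_self (mul_ne_zero this hj)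
  · simp

/-- The product of two such functions is `w` times a polynomial of degree at most `2 * m`; this is
where the moment bound comes from. -/
theorem integrableOn_mul_laguerreFun_mul {α : ℝ} {m : ℕ} {F : ℝ → ℝ}
    (hF : ∀ k ≤ 2 * m, IntegrableOn (fun x => F x * x ^ k * weight α x) (Set.Ici 0))
    {j k : ℕ} (hj : j ≤ m) (hk : k ≤ m) :
    IntegrableOn (fun x => F x * (laguerreFun α j x * laguerreFun α k x)) (Set.Ici 0) := by
  set c := Real.sqrt (j.factorial / Real.Gamma (j + α + 1)) *
      Real.sqrt (k.factorial / Real.Gamma (k + α + 1))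
  have h : IntegrableOn (fun x => ∑ i ∈ Finset.range (j + 1), ∑ i' ∈ Finset.range (k + 1),
      c * (laguerreCoeff α j i * laguerreCoeff α k i') * (F x * x ^ (i + i') * weight α x))
      (Set.Ici 0) := by
    refine integrable_finsetSum _ fun i hi => integrable_finsetSum _ fun i' hi' => ?_
    rw [Finset.mem_range] at hi hi'
    exact (hF (i + i') (by omega)).const_mul _
  refine h.congr_fun (fun x hx => ?_) measurableSet_Ici
  simp only
  rw [laguerreFun_mul_laguerreFun α j k hx, laguerre_eq_sum α j, laguerre_eq_sum α k,
    Finset.sum_mul_sum, Finset.sum_mul, Finset.mul_sum, Finset.mul_sum]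
  refine Finset.sum_congr rfl fun i _ => ?_
  rw [Finset.sum_mul, Finset.mul_sum, Finset.mul_sum]
  refine Finset.sum_congr rfl fun i' _ => ?_
  ring

/-- The monic multiple of the Laguerre polynomial `L_k^{(α)}`. -/
noncomputable def monicLaguerre (α : ℝ) (k : ℕ) : ℝ[X] :=
  ∑ i ∈ Finset.range (k + 1), C ((-1) ^ k * k.factorial * laguerreCoeff α k i) * X ^ i

theorem monicLaguerre_coeff (α : ℝ) (k i : ℕ) : (monicLaguerre α k).coeff i =
    if i ∈ Finset.range (k + 1) then (-1) ^ k * k.factorial * laguerreCoeff α k i else 0 := by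
  simp only [monicLaguerre, finsetSum_coeff, coeff_C_mul_X_pow]
  rw [Finset.sum_ite_eq]

theorem monicLaguerre_coeff_self {α : ℝ} (hα : 0 ≤ α) (k : ℕ) :
    (monicLaguerre α k).coeff k = 1 := by
  have h : (k.factorial : ℝ) ≠ 0 := by positivity
  have h' : ((-1 : ℝ) ^ k) * (-1) ^ k = 1 := by rw [← mul_pow]; simp
  rw [monicLaguerre_coeff, if_pos (by simp), laguerreCoeff_self hα]
  field_simp
  rw [sq, h']

theorem natDegree_monicLaguerre {α : ℝ} (hα : 0 ≤ α) (k : ℕ) :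
    (monicLaguerre α k).natDegree = k := by
  refine natDegree_eq_of_le_of_coeff_ne_zero ?_ (by rw [monicLaguerre_coeff_self hα]; simp)
  rw [natDegree_le_iff_coeff_eq_zero]
  intro i hi
  rw [monicLaguerre_coeff, if_neg (by simpa using hi)]

theorem monic_monicLaguerre {α : ℝ} (hα : 0 ≤ α) (k : ℕ) : (monicLaguerre α k).Monic := by
  rw [Monic, leadingCoeff, natDegree_monicLaguerre hα, monicLaguerre_coeff_self hα]

theorem eval_monicLaguerre (α : ℝ) (k : ℕ) (x : ℝ) :
    (monicLaguerre α k).eval x = (-1) ^ k * k.factorial * laguerre α k x := by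
  rw [monicLaguerre, eval_finsetSum, laguerre_eq_sum, Finset.mul_sum]
  refine Finset.sum_congr rfl fun i _ => ?_
  simp [mul_assoc]

/-- The density of the ensemble is a multiple of the square of a determinant of orthonormal
functions. -/
theorem exists_density_eq_det_sq {α : ℝ} (hα : 0 ≤ α) (n : ℕ) :
    ∃ C : ℝ, 0 < C ∧ ∀ x : Fin n → ℝ, (∀ i, 0 ≤ x i) →
      (∏ i, ∏ j ∈ Finset.Ioi i, (x i - x j) ^ 2) * ∏ i, weight α (x i) =
        C * (Matrix.of fun i j : Fin n => laguerreFun α j (x i)).det ^ 2 := by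
  -- The factor relating each orthonormal function to √w times a monic polynomial; monic polynomials
  -- leave the Vandermonde determinant unchanged.
  set a : Fin n → ℝ := fun j =>
    Real.sqrt ((j : ℕ).factorial / Real.Gamma (j + α + 1)) * ((-1) ^ (j : ℕ) / (j : ℕ).factorial)
  have ha : ∀ j, a j ≠ 0 := fun j => by
    have := (Real.sqrt_pos.2 (normalization_pos hα j)).ne'
    have h2 : ((j : ℕ).factorial : ℝ) ≠ 0 := by positivity
    exact mul_ne_zero this (div_ne_zero (by simp) h2)
  have hprod : ∏ j, a j ≠ 0 := Finset.prod_ne_zero_iff.2 fun j _ => ha j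
  refine ⟨((∏ j, a j) ^ 2)⁻¹, by positivity, fun x hx => ?_⟩
  have hfun : ∀ i j : Fin n, laguerreFun α j (x i) =
      Real.sqrt (weight α (x i)) * (a j * (monicLaguerre α j).eval (x i)) := by
    intro i j
    have h2 : ((j : ℕ).factorial : ℝ) ≠ 0 := by positivity
    have h' : ((-1 : ℝ) ^ (j : ℕ)) * (-1) ^ (j : ℕ) = 1 := by rw [← mul_pow]; simp
    rw [eval_monicLaguerre, laguerreFun]
    simp only [a]
    field_simp
    rw [sq, h', mul_one]
  have hdet : (Matrix.of fun i j : Fin n => laguerreFun α j (x i)).det =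
      (∏ i, Real.sqrt (weight α (x i))) * ((∏ j, a j) * (Matrix.vandermonde x).det) := by
    rw [Matrix.det_eval_matrixOfPolynomials_eq_det_vandermonde x
      (fun j => monicLaguerre α j) (fun j => natDegree_monicLaguerre hα j)
      (fun j => monic_monicLaguerre hα j), ← Matrix.det_mul_row, ← Matrix.det_mul_column]
    congr 1
    ext i j
    exact hfun i j
  have hw : (∏ i, Real.sqrt (weight α (x i))) ^ 2 = ∏ i, weight α (x i) := by
    rw [← Finset.prod_pow]
    exact Finset.prod_congr rfl fun i _ => Real.sq_sqrt (weight_nonneg α (hx i))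
  have hv : (Matrix.vandermonde x).det ^ 2 = ∏ i, ∏ j ∈ Finset.Ioi i, (x i - x j) ^ 2 := by
    rw [Matrix.det_vandermonde, ← Finset.prod_pow]
    refine Finset.prod_congr rfl fun i _ => ?_
    rw [← Finset.prod_pow]
    refine Finset.prod_congr rfl fun j _ => ?_
    ring
  rw [hdet, mul_pow, mul_pow, hw, hv]
  field_simp

end WishartLaguerre

/-! ### Joint moments as coefficients of Gram determinants. -/

namespace SubsetSeries

variable {ι : Type*} [DecidableEq ι]

theorem intCast_mul_apply (n : ℤ) (a : SubsetSeries ι) (S : Finset ι) :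
    ((n : SubsetSeries ι) * a) S = n * a S := by
  obtain ⟨k, rfl | rfl⟩ := n.eq_nat_or_neg
  · simpa using natCast_mul_apply k a S
  · simpa using natCast_mul_apply k a S

end SubsetSeries

/-- For fixed `τ` the inner sum is the determinant with permuted columns, whose sign cancels that of
`τ`; hence all `n!` choices of `τ` contribute equally. -/
theorem Matrix.sum_sign_mul_sign_mul_prod {R : Type*} [CommRing R] {n : ℕ}
    (G : Matrix (Fin n) (Fin n) R) :
    ∑ σ : Equiv.Perm (Fin n), ∑ τ : Equiv.Perm (Fin n),
      ((Equiv.Perm.sign σ : ℤ) : R) * (((Equiv.Perm.sign τ : ℤ) : R) * ∏ i, G (σ i) (τ i)) =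
      n.factorial * G.det := by
  rw [Finset.sum_comm]
  have : ∀ τ : Equiv.Perm (Fin n), ∑ σ : Equiv.Perm (Fin n),
      ((Equiv.Perm.sign σ : ℤ) : R) * (((Equiv.Perm.sign τ : ℤ) : R) * ∏ i, G (σ i) (τ i)) =
      G.det := by
    intro τ
    have h1 := Matrix.det_permute' τ G
    have h2 : ((Equiv.Perm.sign τ : ℤ) : R) * ((Equiv.Perm.sign τ : ℤ) : R) = 1 := by
      rcases Int.units_eq_one_or (Equiv.Perm.sign τ) with h | h <;> simp [h]
    rw [Matrix.det_apply'] at h1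
    calc _ = ((Equiv.Perm.sign τ : ℤ) : R) * ∑ σ : Equiv.Perm (Fin n),
          ((Equiv.Perm.sign σ : ℤ) : R) * ∏ i, G.submatrix id τ (σ i) i := by
          rw [Finset.mul_sum]
          refine Finset.sum_congr rfl fun σ _ => ?_
          simp only [Matrix.submatrix_apply, id]
          ring
      _ = G.det := by rw [h1, ← mul_assoc, h2, one_mul]
  rw [Finset.sum_congr rfl fun τ _ => this τ]
  simp [Fintype.card_perm]

namespace WishartLaguerre

open SubsetSeries

variable {l : ℕ}

/-- The Gram matrix of the orthonormal functions with respect to the generating function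
`exp (∑ r, t r * f r)`. -/
noncomputable def gram (α : ℝ) (f : Fin l → ℝ → ℝ) (j k : ℕ) : SubsetSeries (Fin l) :=
  ⟨fun B => ∫ x in Set.Ici 0, (∏ r ∈ B, f r x) * (laguerreFun α j x * laguerreFun α k x)⟩

/-- The Gram matrix without its constant term, the identity matrix. -/
noncomputable def gramPos (α : ℝ) (f : Fin l → ℝ → ℝ) (j k : ℕ) : SubsetSeries (Fin l) :=
  gram α f j k - if j = k then 1 else 0

theorem gramPos_comm (α : ℝ) (f : Fin l → ℝ → ℝ) (j k : ℕ) :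
    gramPos α f j k = gramPos α f k j := by
  rw [gramPos, gramPos, gram, gram]
  simp only [mul_comm (laguerreFun α j _), eq_comm (a := j)]

theorem gramPos_empty {α : ℝ} (hα : 0 ≤ α) (f : Fin l → ℝ → ℝ) (j k : ℕ) :
    gramPos α f j k ∅ = 0 := by
  rw [gramPos, sub_apply, gram]
  simp only [Finset.prod_empty, one_mul, integral_laguerreFun_mul hα j k]
  split_ifs <;> simp

theorem gramPos_apply_of_nonempty (α : ℝ) (f : Fin l → ℝ → ℝ) (j k : ℕ) {B : Finset (Fin l)}
    (hB : B.Nonempty) : gramPos α f j k B =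
      ∫ x in Set.Ici 0, (∏ r ∈ B, f r x) * (laguerreFun α j x * laguerreFun α k x) := by
  rw [gramPos, sub_apply, gram]
  have : (if j = k then (1 : SubsetSeries (Fin l)) else 0) B = 0 := by
    split_ifs <;> simp [one_apply, hB.ne_empty]
  rw [this, sub_zero]

theorem leadingMinor_gramPos (α : ℝ) (f : Fin l → ℝ → ℝ) (n : ℕ) :
    leadingMinor (gramPos α f) n = (Matrix.of fun j k : Fin n => gram α f j k).det := by
  rw [leadingMinor]
  congr 1
  ext1 j k
  simp [gramPos, Matrix.one_apply, Fin.ext_iff]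

theorem volume_restrict_pi_Ici (κ : Type*) [Fintype κ] :
    (volume : Measure (κ → ℝ)).restrict (Set.univ.pi fun _ => Set.Ici 0) =
      Measure.pi fun _ => volume.restrict (Set.Ici (0 : ℝ)) :=
  Measure.restrict_pi_pi _ _

/-- Andréief's identity for the product of two equal determinants, with the exponential of the
linear statistics inserted. -/
theorem integral_det_sq_mul_expLinear {α : ℝ} {m : ℕ} {f : Fin l → ℝ → ℝ}
    (hf : ∀ s : Finset (Fin l), ∀ k ≤ 2 * m, IntegrableOn
      (fun x => (∏ r ∈ s, f r x) * x ^ k * weight α x) (Set.Ici 0))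
    {n : ℕ} (hn : n ≤ m + 1) (S : Finset (Fin l)) :
    ∫ x : Fin n → ℝ in Set.univ.pi fun _ => Set.Ici 0,
      (Matrix.of fun i j : Fin n => laguerreFun α j (x i)).det ^ 2 *
        ∏ r ∈ S, linearStatistic (f r) n x = n.factorial * leadingMinor (gramPos α f) n S := by
  have hexp : ∀ x : Fin n → ℝ, (Matrix.of fun i j : Fin n => laguerreFun α j (x i)).det ^ 2 *
        ∏ r ∈ S, linearStatistic (f r) n x =
      ∑ σ : Equiv.Perm (Fin n), ∑ τ : Equiv.Perm (Fin n), ∑ g ∈ orderedPartitions n S,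
        ((Equiv.Perm.sign σ : ℤ) : ℝ) * (((Equiv.Perm.sign τ : ℤ) : ℝ) *
          ∏ i, (∏ r ∈ g i, f r (x i)) *
            (laguerreFun α (σ i) (x i) * laguerreFun α (τ i) (x i))) := by
    intro x
    have h1 : ∏ r ∈ S, linearStatistic (f r) n x =
        ∑ g ∈ orderedPartitions n S, ∏ i, ∏ r ∈ g i, f r (x i) := by
      have h := prod_apply (fun i => expLinear fun r => f r (x i)) S
      rw [← expLinear_sum] at h
      simpa [expLinear, linearStatistic] using h
    rw [h1, ← Matrix.det_transpose, Matrix.det_apply', sq, Finset.sum_mul_sum, Finset.sum_mul]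
    refine Finset.sum_congr rfl fun σ _ => ?_
    rw [Finset.sum_mul]
    refine Finset.sum_congr rfl fun τ _ => ?_
    rw [Finset.mul_sum]
    refine Finset.sum_congr rfl fun g _ => ?_
    simp only [Matrix.transpose_apply, Matrix.of_apply, Finset.prod_mul_distrib]
    ring
  have hterm : ∀ (σ τ : Equiv.Perm (Fin n)) (g : Fin n → Finset (Fin l)),
      Integrable (fun x : Fin n → ℝ => ((Equiv.Perm.sign σ : ℤ) : ℝ) *
        (((Equiv.Perm.sign τ : ℤ) : ℝ) * ∏ i, (∏ r ∈ g i, f r (x i)) *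
            (laguerreFun α (σ i) (x i) * laguerreFun α (τ i) (x i))))
        (Measure.pi fun _ => volume.restrict (Set.Ici (0 : ℝ))) := by
    intro σ τ g
    refine Integrable.const_mul (Integrable.const_mul (Integrable.fintype_prod
      (f := fun i x => (∏ r ∈ g i, f r x) * (laguerreFun α (σ i) x * laguerreFun α (τ i) x))
      fun i => ?_) _) _
    exact integrableOn_mul_laguerreFun_mul (hf (g i)) (by omega) (by omega)
  simp only [hexp]
  rw [volume_restrict_pi_Ici, integral_finsetSum _ fun σ _ => integrable_finsetSum _ fun τ _ =>
    integrable_finsetSum _ fun g _ => hterm σ τ g, leadingMinor_gramPos, ← natCast_mul_apply,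
    ← Matrix.sum_sign_mul_sign_mul_prod, SubsetSeries.sum_apply]
  refine Finset.sum_congr rfl fun σ _ => ?_
  rw [integral_finsetSum _ fun τ _ => integrable_finsetSum _ fun g _ => hterm σ τ g,
    SubsetSeries.sum_apply]
  refine Finset.sum_congr rfl fun τ _ => ?_
  rw [integral_finsetSum _ fun g _ => hterm σ τ g, intCast_mul_apply, intCast_mul_apply, prod_apply,
    Finset.mul_sum, Finset.mul_sum]
  refine Finset.sum_congr rfl fun g _ => ?_
  rw [integral_const_mul, integral_const_mul, integral_fintype_prod_eq_prod
    (fun i x => (∏ r ∈ g i, f r x) * (laguerreFun α (σ i) x * laguerreFun α (τ i) x))]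
  rfl

theorem integral_unnormalizedEnsemble (α : ℝ) (n : ℕ) (g : (Fin n → ℝ) → ℝ) :
    ∫ x, g x ∂unnormalizedEnsemble α n =
      ∫ x : Fin n → ℝ in Set.univ.pi fun _ => Set.Ici 0,
        ((∏ i, ∏ j ∈ Finset.Ioi i, (x i - x j) ^ 2) * ∏ i, weight α (x i)) * g x := by
  have hmeas : Measurable fun x : Fin n → ℝ =>
      ENNReal.ofReal ((∏ i, ∏ j ∈ Finset.Ioi i, (x i - x j) ^ 2) * ∏ i, weight α (x i)) := by
    have := measurable_weight α
    fun_prop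
  rw [unnormalizedEnsemble, integral_withDensity_eq_integral_toReal_smul hmeas (by simp)]
  refine setIntegral_congr_fun (MeasurableSet.univ_pi fun _ => measurableSet_Ici) fun x hx => ?_
  simp only [smul_eq_mul]
  rw [ENNReal.toReal_ofReal]
  exact mul_nonneg (Finset.prod_nonneg fun i _ => Finset.prod_nonneg fun j _ => sq_nonneg _)
    (Finset.prod_nonneg fun i _ => weight_nonneg α (hx i trivial))

/-- The joint moments of the linear statistics are coefficients of a Gram determinant. -/
theorem integral_prod_linearStatistic {α : ℝ} (hα : 0 ≤ α) {m : ℕ} {f : Fin l → ℝ → ℝ}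
    (hf : ∀ s : Finset (Fin l), ∀ k ≤ 2 * m, IntegrableOn
      (fun x => (∏ r ∈ s, f r x) * x ^ k * weight α x) (Set.Ici 0))
    {n : ℕ} (hn : n ≤ m + 1) (S : Finset (Fin l)) :
    ∫ x, ∏ r ∈ S, linearStatistic (f r) n x ∂ensemble α n = leadingMinor (gramPos α f) n S := by
  obtain ⟨C, hC, hdens⟩ := exists_density_eq_det_sq hα n
  have key : ∀ S : Finset (Fin l),
      ∫ x, ∏ r ∈ S, linearStatistic (f r) n x ∂unnormalizedEnsemble α n =
        C * (n.factorial * leadingMinor (gramPos α f) n S) := by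
    intro S
    rw [integral_unnormalizedEnsemble, ← integral_det_sq_mul_expLinear hf hn S,
      ← integral_const_mul]
    refine setIntegral_congr_fun (MeasurableSet.univ_pi fun _ => measurableSet_Ici) fun x hx => ?_
    rw [hdens x fun i => hx i trivial, mul_assoc]
  -- The empty product yields the total mass `C * n!`, so both constants cancel on normalisation.
  have hZ := key ∅
  rw [leadingMinor_apply_empty (gramPos_empty hα f)] at hZ
  simp only [Finset.prod_empty, integral_const, smul_eq_mul, mul_one, Measure.real] at hZ
  have hfac : (n.factorial : ℝ) ≠ 0 := by positivity
  rw [ensemble, integral_smul_measure, key, ENNReal.toReal_inv, hZ, smul_eq_mul]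
  field_simp

theorem cumulant_eq_partitionSum {α : ℝ} (hα : 0 ≤ α) {m : ℕ} {f : Fin l → ℝ → ℝ}
    (hf : ∀ s : Finset (Fin l), ∀ k ≤ 2 * m, IntegrableOn
      (fun x => (∏ r ∈ s, f r x) * x ^ k * weight α x) (Set.Ici 0))
    {n : ℕ} (hn : n ≤ m + 1) (p : Finset (Fin l)) :
    cumulant α n f p = partitionSum (fun k => (-1) ^ (k - 1) * ((k - 1).factorial : ℝ))
      (leadingMinor (gramPos α f) n) p := by
  rw [cumulant, jointCumulant, partitionSum_apply]
  refine Finset.sum_congr rfl fun P _ => ?_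
  rw [Finset.prod_congr rfl fun B _ => integral_prod_linearStatistic hα hf hn B]

end WishartLaguerre

/-! ### From cyclic integrals over set partitions to closed paths. -/

/-- The cyclic permutations of a finite type with a marked point are the enumerations of it. -/
theorem sum_isCycleOn_eq_sum_equiv {B : Type*} [Fintype B] [DecidableEq B]
    [DecidablePred fun σ : Equiv.Perm B => σ.IsCycleOn Set.univ] {q : ℕ}
    (hB : Fintype.card B = q + 1) (F : Equiv.Perm B → B → ℝ) :
    ∑ σ : Equiv.Perm B with σ.IsCycleOn Set.univ, ∑ v, F σ v =
      ∑ e : Fin (q + 1) ≃ B, F (e.permCongr (finRotate (q + 1))) (e 0) := by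
  have hpow : ∀ (e : Fin (q + 1) ≃ B) (n : ℕ) (hn : n < q + 1),
      ((e.permCongr (finRotate (q + 1))) ^ n) (e 0) = e ⟨n, hn⟩ := by
    intro e n
    induction n with
    | zero => exact fun _ => rfl
    | succ n ih =>
      intro hn
      rw [pow_succ', Equiv.Perm.mul_apply, ih (by omega), Equiv.permCongr_apply,
        Equiv.symm_apply_apply, finRotate_of_lt (by omega)]
  rw [← Finset.sum_product']
  symm
  refine Finset.sum_bij (fun e _ => (e.permCongr (finRotate (q + 1)), e 0)) ?_ ?_ ?_ ?_
  · intro e _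
    simp only [Finset.mem_product, Finset.mem_filter, Finset.mem_univ, true_and, and_true]
    have hsame : ∀ b, (e.permCongr (finRotate (q + 1))).SameCycle (e 0) b := by
      intro b
      refine ⟨((e.symm b : Fin (q + 1)) : ℕ), ?_⟩
      rw [zpow_natCast, hpow e _ (e.symm b).2]
      simp
    exact ⟨Set.bijOn_univ.2 (Equiv.bijective _), fun x _ y _ => (hsame x).symm.trans (hsame y)⟩
  · intro e _ e' _ h
    rw [Prod.mk.injEq] at h
    ext i
    rw [← hpow e i i.2, ← hpow e' i i.2, h.1, h.2]
  · rintro ⟨σ, v⟩ h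
    simp only [Finset.mem_product, Finset.mem_filter, Finset.mem_univ, true_and, and_true] at h
    have h' : σ.IsCycleOn ((Finset.univ : Finset B) : Set B) := by simpa using h
    have hcard : (Finset.univ : Finset B).card = q + 1 := by rw [Finset.card_univ, hB]
    -- The enumeration is the orbit of the marked point: `i` goes to `σ ^ i` applied to `v`.
    have hbij : Function.Bijective fun i : Fin (q + 1) => (σ ^ (i : ℕ)) v := by
      rw [Fintype.bijective_iff_surjective_and_card]
      refine ⟨fun b => ?_, by simp [hB]⟩
      obtain ⟨n, hn, hb⟩ := h'.exists_pow_eq (Finset.mem_univ v) (Finset.mem_univ b)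
      exact ⟨⟨n, hcard ▸ hn⟩, hb⟩
    obtain ⟨e, he⟩ : ∃ e : Fin (q + 1) ≃ B, ∀ i, e i = (σ ^ (i : ℕ)) v :=
      ⟨Equiv.ofBijective _ hbij, fun _ => rfl⟩
    refine ⟨e, Finset.mem_univ _, Prod.ext (Equiv.ext fun b => ?_) (by simp [he])⟩
    obtain ⟨i, rfl⟩ := e.surjective b
    change e.permCongr (finRotate (q + 1)) (e i) = σ (e i)
    rw [Equiv.permCongr_apply, Equiv.symm_apply_apply, he, he, ← Equiv.Perm.mul_apply, ← pow_succ']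
    induction i using Fin.lastCases with
    | last =>
      have := h'.pow_card_apply (Finset.mem_univ v)
      rw [hcard] at this
      simp [this]
    | cast i => simp
  · intro e _
    rfl

/-- An ordered partition without empty blocks is a partition with an enumeration of its blocks. -/
theorem Finpartition.sum_sum_equiv_parts {ι : Type*} [DecidableEq ι] [Fintype ι] (S : Finset ι)
    (n : ℕ) (F : (Fin n → Finset ι) → ℝ) :
    ∑ P : Finpartition S, ∑ e : Fin n ≃ P.parts, F (fun i => e i) =
      ∑ g ∈ SubsetSeries.orderedPartitions n S with ∀ i, (g i).Nonempty, F g := by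
  rw [Finset.sum_sigma']
  refine Finset.sum_bij (fun x _ i => x.2 i) ?_ ?_ ?_ ?_
  · rintro ⟨P, e⟩ _
    rw [Finset.mem_filter, SubsetSeries.mem_orderedPartitions]
    refine ⟨⟨fun i j hij => ?_, ?_⟩, fun i => P.nonempty_of_mem_parts (e i).2⟩
    · exact P.disjoint (e i).2 (e j).2 fun h => hij (e.injective (Subtype.ext h))
    · ext r
      simp only [Finset.mem_biUnion, Finset.mem_univ, true_and]
      constructor
      · rintro ⟨i, hi⟩
        exact P.le (e i).2 hi
      · intro hr
        obtain ⟨B, hB, hrB⟩ := P.exists_mem hr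
        exact ⟨e.symm ⟨B, hB⟩, by simpa using hrB⟩
  · rintro ⟨P, e⟩ _ ⟨P', e'⟩ _ h
    have hparts : ∀ (P : Finpartition S) (e : Fin n ≃ P.parts),
        P.parts = Finset.univ.image fun i => (e i : Finset ι) := by
      intro P e
      ext B
      simp only [Finset.mem_image, Finset.mem_univ, true_and]
      constructor
      · exact fun hB => ⟨e.symm ⟨B, hB⟩, by simp⟩
      · rintro ⟨i, rfl⟩
        exact (e i).2
    have hP : P = P' := by
      apply Finpartition.ext
      rw [hparts P e, hparts P' e']
      exact congrArg (fun g => Finset.univ.image g) h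
    subst hP
    have : e = e' := Equiv.ext fun i => Subtype.ext (congrFun h i)
    rw [this]
  · intro g hg
    rw [Finset.mem_filter, SubsetSeries.mem_orderedPartitions] at hg
    obtain ⟨⟨hd, hS⟩, hne⟩ := hg
    have hinj : Function.Injective g := fun i j hij => by
      by_contra hne'
      have := hd hne'
      rw [Function.onFun, hij, disjoint_self] at this
      exact (hne j).ne_empty this
    let P : Finpartition S :=
      { parts := Finset.univ.image g
        supIndep := by
          rw [Finset.supIndep_iff_pairwiseDisjoint]
          intro B hB C hC hBC
          obtain ⟨i, -, rfl⟩ := Finset.mem_image.1 hB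
          obtain ⟨j, -, rfl⟩ := Finset.mem_image.1 hC
          exact hd fun h => hBC (by rw [h])
        sup_parts := by
          rw [← hS, Finset.sup_image, Finset.sup_eq_biUnion]
          rfl
        bot_notMem := by
          simp only [Finset.mem_image, Finset.mem_univ, true_and, not_exists]
          exact fun i hi => (hne i).ne_empty hi }
    have hbij : Function.Bijective
        fun i => (⟨g i, Finset.mem_image_of_mem g (Finset.mem_univ i)⟩ : P.parts) := by
      refine ⟨fun i j hij => hinj (congrArg Subtype.val hij), fun B => ?_⟩
      obtain ⟨i, -, hi⟩ := Finset.mem_image.1 B.2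
      exact ⟨i, Subtype.ext hi⟩
    exact ⟨⟨P, Equiv.ofBijective _ hbij⟩, by simp, rfl⟩
  · intro x _
    rfl

theorem prod_finRotate_symm {R : Type*} [CommMonoid R] {q : ℕ} (A : ℕ → ℕ → R)
    (k : Fin (q + 1) → ℕ) :
    ∏ i, A (k i) (k ((finRotate (q + 1)).symm i)) =
      (∏ i : Fin q, A (k i.succ) (k i.castSucc)) * A (k 0) (k (Fin.last q)) := by
  have h0 : (finRotate (q + 1)).symm 0 = Fin.last q := by
    rw [Equiv.symm_apply_eq, finRotate_last]
  have hs : ∀ i : Fin q, (finRotate (q + 1)).symm i.succ = i.castSucc := fun i => by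
    rw [Equiv.symm_apply_eq, finRotate_apply, Fin.coeSucc_eq_succ]
  rw [Fin.prod_univ_succ, h0, mul_comm]
  simp only [hs]

namespace WishartLaguerre

open SubsetSeries

variable {l : ℕ}

/-- Each kernel on the cycle contributes an index: `c` at the marked block and `κ i < m` elsewhere.
The variable of a block then carries the functions of its outgoing and incoming kernels, so the
integral factors over the blocks. -/
theorem integral_cycle {α : ℝ} (hα : 0 ≤ α) {m c q : ℕ} (hc : c ≤ m) {B : Type*} [Fintype B]
    [DecidableEq B] (e : Fin (q + 1) ≃ B) {F : B → ℝ → ℝ}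
    (hF : ∀ b, ∀ k ≤ 2 * m, IntegrableOn (fun x => F b x * x ^ k * weight α x) (Set.Ici 0)) :
    ∫ x : B → ℝ in Set.univ.pi fun _ => Set.Ici 0,
      laguerreTerm α c (x (e 0)) (x (e.permCongr (finRotate (q + 1)) (e 0))) *
        (∏ b, F b (x b)) * ∏ b ∈ Finset.univ.erase (e 0),
          corrKernel α m (x b) (x (e.permCongr (finRotate (q + 1)) b)) =
      ∑ κ : Fin q → Fin m, ∏ i, ∫ x in Set.Ici 0, F (e i) x *
        (laguerreFun α ((Fin.cons c (fun i => (κ i : ℕ)) : Fin (q + 1) → ℕ) i) x *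
          laguerreFun α ((Fin.cons c (fun i => (κ i : ℕ)) : Fin (q + 1) → ℕ)
            ((finRotate (q + 1)).symm i)) x) := by
  set Ψ : (Fin q → Fin m) → B → ℝ → ℝ := fun κ b x => F b x *
    (laguerreFun α ((Fin.cons c (fun i => (κ i : ℕ)) : Fin (q + 1) → ℕ) (e.symm b)) x *
      laguerreFun α ((Fin.cons c (fun i => (κ i : ℕ)) : Fin (q + 1) → ℕ)
        ((finRotate (q + 1)).symm (e.symm b))) x) with hΨ
  have hle : ∀ (κ : Fin q → Fin m) (i : Fin (q + 1)),
      (Fin.cons c (fun i => (κ i : ℕ)) : Fin (q + 1) → ℕ) i ≤ m := by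
    intro κ i
    induction i using Fin.cases with
    | zero => exact hc
    | succ i => exact (κ i).2.le
  have hterm : ∀ κ : Fin q → Fin m, Integrable (fun x : B → ℝ => ∏ b, Ψ κ b (x b))
      (Measure.pi fun _ => volume.restrict (Set.Ici (0 : ℝ))) := fun κ =>
    Integrable.fintype_prod fun b => integrableOn_mul_laguerreFun_mul (hF b) (hle κ _) (hle κ _)
  have hexp : ∀ x ∈ Set.univ.pi (fun _ : B => Set.Ici (0 : ℝ)),
      laguerreTerm α c (x (e 0)) (x (e.permCongr (finRotate (q + 1)) (e 0))) *
        (∏ b, F b (x b)) * ∏ b ∈ Finset.univ.erase (e 0),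
          corrKernel α m (x b) (x (e.permCongr (finRotate (q + 1)) b)) =
      ∑ κ : Fin q → Fin m, ∏ b, Ψ κ b (x b) := by
    intro x hx
    have hx' : ∀ b, 0 ≤ x b := fun b => hx b trivial
    have hK : ∀ b b', corrKernel α m (x b) (x b') =
        ∑ j : Fin m, laguerreFun α j (x b) * laguerreFun α j (x b') := by
      intro b b'
      rw [corrKernel, Finset.sum_range]
      exact Finset.sum_congr rfl fun j _ => laguerreTerm_eq hα j (hx' b)
    have herase : ∏ b ∈ Finset.univ.erase (e 0),
          corrKernel α m (x b) (x (e.permCongr (finRotate (q + 1)) b)) =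
        ∏ i : Fin q, ∑ j : Fin m, laguerreFun α j (x (e i.succ)) *
          laguerreFun α j (x (e (finRotate (q + 1) i.succ))) := by
      symm
      refine Finset.prod_bij (fun i _ => e i.succ) ?_ ?_ ?_ ?_
      · intro i _
        simp
      · intro i _ j _ h
        simpa using h
      · intro b hb
        have hb' : e.symm b ≠ 0 := fun h => by
          rw [Equiv.symm_apply_eq] at h
          simp [h] at hb
        obtain ⟨i, hi⟩ := Fin.exists_succ_eq.2 hb'
        exact ⟨i, Finset.mem_univ _, by rw [hi]; simp⟩
      · intro i _
        rw [hK]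
        simp [Equiv.permCongr_apply]
    rw [herase, Finset.prod_univ_sum, Fintype.piFinset_univ, Finset.mul_sum,
      laguerreTerm_eq hα c (hx' _)]
    refine Finset.sum_congr rfl fun κ _ => ?_
    set k : Fin (q + 1) → ℕ := Fin.cons c (fun i => (κ i : ℕ)) with hk
    have h1 : laguerreFun α c (x (e 0)) *
        laguerreFun α c (x (e.permCongr (finRotate (q + 1)) (e 0))) *
        ∏ i : Fin q, laguerreFun α (κ i) (x (e i.succ)) *
          laguerreFun α (κ i) (x (e (finRotate (q + 1) i.succ))) =
        ∏ i, laguerreFun α (k i) (x (e i)) * laguerreFun α (k i) (x (e (finRotate (q + 1) i))) := by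
      rw [Fin.prod_univ_succ]
      simp [hk, Equiv.permCongr_apply]
    -- Reindexing by the rotation moves the second function of each kernel to the variable it
    -- depends on.
    have h2 : ∏ i, laguerreFun α (k i) (x (e (finRotate (q + 1) i))) =
        ∏ i, laguerreFun α (k ((finRotate (q + 1)).symm i)) (x (e i)) := by
      rw [← Equiv.prod_comp (finRotate (q + 1))
        fun i => laguerreFun α (k ((finRotate (q + 1)).symm i)) (x (e i))]
      simp only [Equiv.symm_apply_apply]
    rw [mul_right_comm, h1, Finset.prod_mul_distrib, h2, ← e.prod_comp fun b => F b (x b),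
      ← e.prod_comp fun b => Ψ κ b (x b), ← Finset.prod_mul_distrib, ← Finset.prod_mul_distrib]
    refine Finset.prod_congr rfl fun i _ => ?_
    simp only [hΨ, Equiv.symm_apply_apply, ← hk]
    ring
  rw [setIntegral_congr_fun (MeasurableSet.univ_pi fun _ => measurableSet_Ici) hexp,
    volume_restrict_pi_Ici, integral_finsetSum _ fun κ _ => hterm κ]
  refine Finset.sum_congr rfl fun κ _ => ?_
  rw [integral_fintype_prod_eq_prod (fun b x => Ψ κ b x), ← e.prod_comp]
  simp only [hΨ, Equiv.symm_apply_apply]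

/-- The decoupled integral is a coefficient of the alternating sum of the closed paths at `c`. -/
theorem decoupledIntegral_eq_signedPathSum {α : ℝ} (hα : 0 ≤ α) {m c : ℕ} (hc : c ≤ m)
    (hl : 1 ≤ l) {f : Fin l → ℝ → ℝ}
    (hf : ∀ s : Finset (Fin l), ∀ k ≤ 2 * m, IntegrableOn
      (fun x => (∏ r ∈ s, f r x) * x ^ k * weight α x) (Set.Ici 0)) :
    decoupledIntegral (corrKernel α m) (laguerreTerm α c) f =
      signedPathSum (gramPos α f) m l c c Finset.univ := by
  let G : (q : ℕ) → (Fin (q + 1) → Finset (Fin l)) → ℝ := fun q g =>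
    ∑ κ : Fin q → Fin m, ∏ i, gramPos α f
      ((Fin.cons c (fun i => (κ i : ℕ)) : Fin (q + 1) → ℕ) i)
      ((Fin.cons c (fun i => (κ i : ℕ)) : Fin (q + 1) → ℕ) ((finRotate (q + 1)).symm i)) (g i)
  have hblock : decoupledIntegral (corrKernel α m) (laguerreTerm α c) f =
      ∑ P : Finpartition (Finset.univ : Finset (Fin l)), ∑ q ∈ Finset.range l,
        (-1) ^ q * ∑ e : Fin (q + 1) ≃ P.parts, G q fun i => e i := by
    rw [decoupledIntegral]
    refine Finset.sum_congr rfl fun P _ => ?_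
    have hle : P.parts.card ≤ l := by simpa using P.card_parts_le_card
    have hpos : P.parts.card ≠ 0 := by
      rw [Finset.card_ne_zero, Finpartition.parts_nonempty_iff]
      have : Nonempty (Fin l) := ⟨⟨0, hl⟩⟩
      exact Finset.univ_nonempty.ne_empty
    obtain ⟨q, hq⟩ := Nat.exists_eq_succ_of_ne_zero hpos
    have hcard : Fintype.card P.parts = q + 1 := by rw [Fintype.card_coe, hq]
    rw [Finset.sum_eq_single q]
    · rw [hq, Nat.succ_sub_one]
      congr 1
      classical
      refine (sum_isCycleOn_eq_sum_equiv hcard _).trans ?_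
      refine Finset.sum_congr rfl fun e _ => ?_
      refine (integral_cycle hα hc e (F := fun b x => ∏ r ∈ b.1, f r x) fun b => hf b.1).trans ?_
      refine Finset.sum_congr rfl fun κ _ => Finset.prod_congr rfl fun i _ => ?_
      -- Blocks are nonempty, so subtracting the identity matrix does not change these entries.
      rw [gramPos_apply_of_nonempty _ _ _ _ (P.nonempty_of_mem_parts (e i).2)]
    · intro q' _ hne
      have : IsEmpty (Fin (q' + 1) ≃ P.parts) := ⟨fun e => hne (by
        have := Fintype.card_congr e
        rw [hcard, Fintype.card_fin] at this
        omega)⟩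
      simp
    · intro h
      simp only [Finset.mem_range] at h
      omega
  rw [hblock, Finset.sum_comm, signedPathSum, SubsetSeries.sum_apply]
  refine Finset.sum_congr rfl fun q _ => ?_
  rw [← Finset.mul_sum, neg_one_pow_mul_apply, Finpartition.sum_sum_equiv_parts, pathSum,
    SubsetSeries.sum_apply, Finset.sum_comm]
  congr 1
  refine Finset.sum_congr rfl fun κ _ => ?_
  have h := prod_finRotate_symm (gramPos α f) (Fin.cons c (fun i => (κ i : ℕ)) : Fin (q + 1) → ℕ)
  rw [Fin.cons_zero] at h
  rw [← h, SubsetSeries.prod_apply, Finset.sum_filter]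
  refine Finset.sum_congr rfl fun g _ => ?_
  split_ifs with hg
  · rfl
  · push Not at hg
    obtain ⟨i, hi⟩ := hg
    refine (Finset.prod_eq_zero (Finset.mem_univ i) ?_).symm
    rw [hi, gramPos_empty hα]

end WishartLaguerre

theorem proposition2 (m l : ℕ) (hm : 1 ≤ m) (hl : 1 ≤ l) (α : ℝ) (hα : 0 ≤ α)
    (f : Fin l → ℝ → ℝ)
    (hf : ∀ s : Finset (Fin l), ∀ k ≤ 2 * m, MeasureTheory.IntegrableOn
      (fun x => (∏ r ∈ s, f r x) * x ^ k * WishartLaguerre.weight α x) (Set.Ici 0)) :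
    WishartLaguerre.integralH α m f =
        ∑ P : Finpartition (Finset.univ : Finset (Fin l)), ∏ p ∈ P.parts,
          (WishartLaguerre.cumulant α (m + 1) f p - WishartLaguerre.cumulant α m f p) ∧
      WishartLaguerre.integralh α m f =
        -∑ P : Finpartition (Finset.univ : Finset (Fin l)), ∏ p ∈ P.parts,
          (WishartLaguerre.cumulant α (m - 1) f p - WishartLaguerre.cumulant α m f p) := by
  have hA := WishartLaguerre.gramPos_empty hα f
  have hcomm := WishartLaguerre.gramPos_comm α f
  have hminor := SubsetSeries.leadingMinor_apply_empty hA
  have hnil : ∀ c d, pathSum (WishartLaguerre.gramPos α f) m l c d = 0 := fun c d => by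
    simpa using SubsetSeries.pathSum_card_eq_zero hA m c d
  have hone : (1 : SubsetSeries (Fin l)) Finset.univ = 0 := by
    have : Nonempty (Fin l) := ⟨⟨0, hl⟩⟩
    rw [SubsetSeries.one_apply, if_neg Finset.univ_nonempty.ne_empty]
  -- Any `u` with u · D_m = D_n must be the exponential of the cumulant differences, because D_m has
  -- constant term 1 and can be cancelled.
  have hexp : ∀ n ≤ m + 1, ∀ u : SubsetSeries (Fin l),
      u * leadingMinor (WishartLaguerre.gramPos α f) m =
        leadingMinor (WishartLaguerre.gramPos α f) n →
      ∑ P : Finpartition (Finset.univ : Finset (Fin l)), ∏ p ∈ P.parts,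
        (WishartLaguerre.cumulant α n f p - WishartLaguerre.cumulant α m f p) =
        u Finset.univ := by
    intro n hn u hu
    have h := SubsetSeries.partitionExp_sub_mul (hminor m) (hminor n)
    have h' := h.trans hu.symm
    rw [← sub_eq_zero, ← sub_mul] at h'
    rw [← sub_eq_zero.1 (SubsetSeries.eq_zero_of_mul_eq_zero (hminor m) h'),
      SubsetSeries.partitionExp_apply]
    refine Finset.sum_congr rfl fun P _ => Finset.prod_congr rfl fun p _ => ?_
    rw [WishartLaguerre.cumulant_eq_partitionSum hα hf hn,
      WishartLaguerre.cumulant_eq_partitionSum hα hf (Nat.le_succ m), SubsetSeries.sub_apply]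
  constructor
  · rw [hexp (m + 1) le_rfl _ (leadingMinor_succ_eq_mul hcomm fun c _ => hnil c m),
      SubsetSeries.add_apply, hone, zero_add]
    exact WishartLaguerre.decoupledIntegral_eq_signedPathSum hα le_rfl hl hf
  -- With m = k + 1 the base point `k` of the paths is the last index of the `m × m` block.
  · obtain ⟨k, rfl⟩ := Nat.exists_eq_add_of_le' hm
    rw [Nat.add_sub_cancel, hexp k (by omega) _ (leadingMinor_mul_one_sub hcomm hnil),
      SubsetSeries.sub_apply, hone, zero_sub, neg_neg]
    exact WishartLaguerre.decoupledIntegral_eq_signedPathSum hα (Nat.le_succ k) hl hf
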